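/- Let $0<p<1$, $K\ge 1$, data points $x_1,\dots,x_K\in\mathbb R$ and $f:\mathbb R\to\mathbb R$. Let $\alpha_k=\cos\frac{(2k-1)\pi}{2K}$ $(1\le k\le K)$ be the encoder points and $\beta_n=\cos\frac{(n-1)\pi}{N-1}$ $(1\le n\le N)$ the decoder points, and put $\Omega=(-1,1)$. Each of $N$ servers is a straggler with probability $p$, independently of the others; $\mathcal F\subseteq\{1,\dots,N\}$ denotes the random set of non-stragglers. A scheme consists of an encoder function $u_{\rm enc}$ and, for each $\mathcal F$, a decoder function $u_{\rm dec}=u_{{\rm dec},\mathcal F}$ built from the values $f(u_{\rm enc}(\beta_v))$, $v\in\mathcal F$. Its approximation error is $\ell(\mathcal F)=\frac1K\sum_{k=1}^K\big(u_{\rm dec}(\alpha_k)-f(x_k)\big)^2$ and its average approximation error is $\mathcal L=\mathrm E_{\mathcal F}[\ell(\mathcal F)]$. (1) LeTCC. Let $K\ge2$, let $f$ be $\nu$-Lipschitz and twice differentiable with $|f''|\le\eta$. The encoder function minimizes $\frac1K\sum_k(u(\alpha_k)-x_k)^2+\lambda_{\rm enc}\int_\Omega (u'')^2$ over $u\in H^2(\Omega)$,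 and for $|\mathcal F|\ge2$ the decoder function minimizes $\frac1{|\mathcal F|}\sum_{v\in\mathcal F}\big(u(\beta_v)-f(u_{\rm enc}(\beta_v))\big)^2+\lambda_{\rm dec}\int_\Omega (u'')^2$ over $u\in H^2(\Omega)$, with $\lambda_{\rm enc},\lambda_{\rm dec}\ge0$; for a parameter equal to $0$ the minimizer with least $\int_\Omega(u'')^2$ is taken (the natural interpolating spline). If $|\mathcal F|<2$, the decoder function may be any $u\in H^2(\Omega)$ with $|u(\alpha_k)|\le M$ for all $k$, where $M$ is a fixed constant. Let $A$ be a constant. Then there are $C$ and $n_0$, depending only on $p,K,(x_k),f,\nu,\eta,A,M$, such that for all $N\ge n_0$, all $\lambda_{\rm dec}\le N^{-6}$ and all $\lambda_{\rm enc}\ge 0$, $$\mathcal L\le C\,\frac{\log_{1/p}^3(N)}{N^3}+\frac2K\sum_{k=1}^K\big(f(u_{\rm enc}(\alpha_k))-f(x_k)\big)^2,$$ and, if $\lambda_{\rm enc}\le A\log_{1/p}^3(N)/N^3$ (for instance $\lambda_{\rm enc}=0$), also $$\mathcal L\le C\,\frac{\log_{1/p}^3(N)}{N^3}.$$ Moreover,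 for every $\delta\in(0,1)$ there are $C$ and $n_0$, depending on the same data and on $\delta$, such that in the same situation each of these two bounds holds for $\ell(\mathcal F)$ in place of $\mathcal L$ with probability at least $1-\delta$. (2) BACC. Let $f\in C^2(\mathbb R)$. The encoder function is Berrut's rational interpolant of the data $(\alpha_k,x_k)$, $1\le k\le K$, and the decoder function is Berrut's rational interpolant of the data $(\beta_v,f(u_{\rm enc}(\beta_v)))$, $v\in\mathcal F$; here Berrut's interpolant of $(t_i,y_i)$, $i=1,\dots,m$, with $t_1>\dots>t_m$, is $z\mapsto\sum_i\frac{(-1)^i}{z-t_i}y_i\big/\sum_i\frac{(-1)^i}{z-t_i}$, with value $y_i$ at $t_i$ (and is $0$ for $m=0$). Then there are $C$ and $n_0$, depending only on $p,K,(x_k),f$, such that $\mathcal L\le C\log_{1/p}^4(N)/N^2$ for all $N\ge n_0$; and for every $\delta\in(0,1)$ there are $C$ and $n_0$, depending also on $\delta$, such that for all $N\ge n_0$, with probability at least $1-\delta$, $\ell(\mathcal F)\le C\log_{1/p}^4(N)/N^2$. (3) Let $\Delta_{\max}$ be the largest distance of consecutive points among the $\beta_n$ and the end points $\pm1$ of $\Omega$,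 and $\Delta_{\min}$ the smallest distance of consecutive $\beta_n$. Then $\Delta_{\max}/\Delta_{\min}=O(N)$ as $N\to\infty$, but $\Delta_{\max}/\Delta_{\min}\to\infty$, so that the ratio is not bounded. -/

import Mathlib

open Real Set Filter Topology MeasureTheory
open scoped NNReal ContDiff

noncomputable section

namespace CodedComputing

/-! ### The Sobolev space of second order on the interval `(-1, 1)` -/

/-- `v` is the weak derivative of `u` on the interval `(-1, 1)`. -/
def HasWeakDeriv (u v : ℝ → ℝ) : Prop :=
  ∀ φ : ℝ → ℝ, ContDiff ℝ ∞ φ → HasCompactSupport φ → tsupport φ ⊆ Ioo (-1) 1 →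
    ∫ t in Ioo (-1 : ℝ) 1, u t * deriv φ t = -∫ t in Ioo (-1 : ℝ) 1, v t * φ t

/-- An element of the Sobolev space `H²((-1, 1))`, given by its representative `toFun` that is
continuous up to the end points (so that it can be evaluated at every point of `[-1, 1]`),
together with its weak derivatives of orders one and two, which are square integrable.
Values of `toFun` outside `[-1, 1]` play no role. -/
structure SobolevH2 where
  toFun : ℝ → ℝ
  d1 : ℝ → ℝ
  d2 : ℝ → ℝ
  continuousOn_toFun : ContinuousOn toFun (Icc (-1) 1)
  memLp_d1 : MemLp d1 2 (volume.restrict (Ioo (-1 : ℝ) 1))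
  memLp_d2 : MemLp d2 2 (volume.restrict (Ioo (-1 : ℝ) 1))
  hasWeakDeriv_d1 : HasWeakDeriv toFun d1
  hasWeakDeriv_d2 : HasWeakDeriv d1 d2

/-- The roughness penalty `∫ (u'')²` over `(-1, 1)`. -/
def SobolevH2.roughness (u : SobolevH2) : ℝ :=
  ∫ t in Ioo (-1 : ℝ) 1, (u.d2 t) ^ 2

/-! ### Mapping points -/

/-- First Chebyshev points (encoder points) `cos ((2k - 1)π / (2K))`, `k = 1, …, K`;
the index of `Fin K` starts at `0`. -/
def encPoint (K : ℕ) (k : Fin K) : ℝ :=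
  cos ((2 * (k : ℝ) + 1) * π / (2 * K))

/-- Second Chebyshev points (decoder points) `cos ((n - 1)π / (N - 1))`, `n = 1, …, N`;
the index of `Fin N` starts at `0`. -/
def decPoint (N : ℕ) (n : Fin N) : ℝ :=
  cos ((n : ℝ) * π / ((N : ℝ) - 1))

/-- The decoder points, in their (decreasing) order, preceded by the end point `1` and followed by
the end point `-1` of the interval. -/
def decPointWithEnds (N n : ℕ) : ℝ :=
  if n = 0 then 1 else if h : n - 1 < N then decPoint N ⟨n - 1, h⟩ else -1

/-- Largest distance of consecutive decoder points, the end points of the interval included. -/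
def maxGap (N : ℕ) : ℝ :=
  ⨆ n : Fin (N + 1), |decPointWithEnds N (n + 1) - decPointWithEnds N n|

/-- Smallest distance of consecutive decoder points. -/
def minGap (N : ℕ) : ℝ :=
  ⨅ n : Fin (N - 1), |decPointWithEnds N (n + 2) - decPointWithEnds N (n + 1)|

/-! ### Random stragglers and the recovery loss -/

/-- Probability that `F` is exactly the set of non-stragglers, when each of the `N` servers is a
straggler with probability `p`, independently of the others. -/
def survivorWeight (p : ℝ) {N : ℕ} (F : Finset (Fin N)) : ℝ :=
  (1 - p) ^ F.card * p ^ (N - F.card)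

/-- Expectation of a quantity that depends on the random set of non-stragglers. -/
def expect (p : ℝ) {N : ℕ} (X : Finset (Fin N) → ℝ) : ℝ :=
  ∑ F : Finset (Fin N), survivorWeight p F * X F

open Classical in
/-- Probability of an event that depends on the random set of non-stragglers. -/
def prob (p : ℝ) {N : ℕ} (E : Finset (Fin N) → Prop) : ℝ :=
  ∑ F : Finset (Fin N) with E F, survivorWeight p F

/-- Approximation error `(1/K) ∑ₖ (u(αₖ) - f(xₖ))²` of the estimates `u(αₖ)` of `f(xₖ)`. -/
def recoveryLoss {K : ℕ} (f : ℝ → ℝ) (x : Fin K → ℝ) (u : ℝ → ℝ) : ℝ :=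
  1 / (K : ℝ) * ∑ k, (u (encPoint K k) - f (x k)) ^ 2

/-! ### Learning theoretic coded computing (LeTCC) -/

/-- The regularised least squares objective for the data `(nodes i, y i)`, `i ∈ s`. -/
def splineObjective {n : ℕ} (s : Finset (Fin n)) (nodes y : Fin n → ℝ) (lam : ℝ)
    (u : SobolevH2) : ℝ :=
  1 / (s.card : ℝ) * ∑ i ∈ s, (u.toFun (nodes i) - y i) ^ 2 + lam * u.roughness

/-- `u` is the (second order) smoothing spline of the data `(nodes i, y i)`, `i ∈ s`: it minimises
the objective over `H²`, and it has the least roughness among all minimisers. The second clause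
is automatic for `lam > 0`; for `lam = 0` it selects the natural interpolating spline among all
interpolants. -/
def IsSmoothingSpline {n : ℕ} (s : Finset (Fin n)) (nodes y : Fin n → ℝ) (lam : ℝ)
    (u : SobolevH2) : Prop :=
  (∀ v : SobolevH2, splineObjective s nodes y lam u ≤ splineObjective s nodes y lam v) ∧
  ∀ v : SobolevH2, splineObjective s nodes y lam v = splineObjective s nodes y lam u →
    u.roughness ≤ v.roughness

/-- `enc` and `dec` are an encoder and a decoder of LeTCC for `f` and the data points `x`, with
`N` servers and Chebyshev points. `dec F` is the decoder function used when `F` is the set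
of non-stragglers. If fewer than two servers respond, the spline problem does not determine
a decoder function; the master node may then return any estimates bounded by `M`. -/
structure IsLeTCC {K N : ℕ} (f : ℝ → ℝ) (x : Fin K → ℝ) (lamEnc lamDec M : ℝ)
    (enc : SobolevH2) (dec : Finset (Fin N) → SobolevH2) : Prop where
  encoder : IsSmoothingSpline Finset.univ (encPoint K) x lamEnc enc
  decoder : ∀ F : Finset (Fin N), 2 ≤ F.card →
    IsSmoothingSpline F (decPoint N) (fun v => f (enc.toFun (decPoint N v))) lamDec (dec F)
  fallback : ∀ F : Finset (Fin N), F.card < 2 → ∀ k, |(dec F).toFun (encPoint K k)| ≤ M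

/-! ### Berrut approximated coded computing (BACC) -/

/-- The sign of node `i` in Berrut's interpolant on the nodes indexed by `s`; the signs alternate
along `s`. -/
def berrutSign {n : ℕ} (s : Finset (Fin n)) (i : Fin n) : ℝ :=
  (-1) ^ (s.filter (· < i)).card

open Classical in
/-- Berrut's rational interpolant of the data `(nodes i, y i)`, `i ∈ s`, with its (removable)
singularities at the nodes filled in. -/
def berrut {n : ℕ} (s : Finset (Fin n)) (nodes y : Fin n → ℝ) (z : ℝ) : ℝ :=
  if h : ∃ i ∈ s, nodes i = z then y h.choose
  else ∑ i ∈ s, (berrutSign s i / (z - nodes i)) /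
    (∑ j ∈ s, berrutSign s j / (z - nodes j)) * y i

/-- The encoder function of BACC. -/
def baccEnc {K : ℕ} (x : Fin K → ℝ) : ℝ → ℝ :=
  berrut Finset.univ (encPoint K) x

/-- The decoder function of BACC with `N` servers, when `F` is the set of non-stragglers. -/
def baccDec {K N : ℕ} (f : ℝ → ℝ) (x : Fin K → ℝ) (F : Finset (Fin N)) : ℝ → ℝ :=
  berrut F (decPoint N) (fun v => f (baccEnc x (decPoint N v)))

/-! ### Rates -/

/-- `log_{1/p}(N)³ / N³`. -/
def leTCCRate (p : ℝ) (N : ℕ) : ℝ := (logb (1 / p) N) ^ 3 / (N : ℝ) ^ 3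

/-- `log_{1/p}(N)⁴ / N²`. -/
def baccRate (p : ℝ) (N : ℕ) : ℝ := (logb (1 / p) N) ^ 4 / (N : ℝ) ^ 2

end CodedComputing

end

/-
Any `⌈7 log_{1/p} N⌉` consecutive servers are all stragglers with probability at most `N⁻⁷`. Hence,
outside an event of probability `N⁻⁶`, every encoder point lies between two surviving decoder points
at distance `h = O(log N / N)`, and on the exceptional event crude bounds of the error suffice.

For LeTCC the roughness of the encoder is at most that of any smooth interpolant of the data, so
`f ∘ u_enc` agrees on `[-1, 1]` with a function `g` in `H²` whose roughness is bounded independently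
of `N`. The decoder is at most as rough as `g` and almost interpolates it at the survivors. As the
derivative of the difference has oscillation `O(√h)` between neighbouring survivors, the difference
itself is `O(h ^ (3 / 2))` there.

For BACC the error of Berrut's interpolant is a quotient of alternating sums. The numerator is an
alternating sum of divided differences of a `C²` function, which depend on the node in a Lipschitz
way, so it is bounded. In the denominator the terms `1 / |z - tᵢ|` decrease away from `z`, and
comparing the first two of them shows that it is at least of order `N / log² N`.
-/

namespace CodedComputing

section Stragglers

variable {p : ℝ} {N : ℕ}

lemma survivorWeight_nonneg (hp0 : 0 ≤ p) (hp1 : p ≤ 1) (F : Finset (Fin N)) :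
    0 ≤ survivorWeight p F :=
  mul_nonneg (pow_nonneg (sub_nonneg.2 hp1) _) (pow_nonneg hp0 _)

lemma sum_powerset_survivorWeight (p : ℝ) (W : Finset (Fin N)) :
    ∑ F ∈ W.powerset, survivorWeight p F = p ^ (N - W.card) := by
  have hsplit : ∀ F ∈ W.powerset, survivorWeight p F =
      (1 - p) ^ F.card * p ^ (W.card - F.card) * p ^ (N - W.card) := by
    intro F hF
    have hFW := Finset.card_le_card (Finset.mem_powerset.1 hF)
    have hWN : W.card ≤ N := card_finset_fin_le W
    rw [survivorWeight, mul_assoc, ← pow_add]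
    congr 2
    omega
  rw [Finset.sum_congr rfl hsplit, ← Finset.sum_mul, Finset.sum_pow_mul_eq_add_pow,
    sub_add_cancel, one_pow, one_mul]

lemma sum_survivorWeight (p : ℝ) (N : ℕ) : ∑ F : Finset (Fin N), survivorWeight p F = 1 := by
  simpa using sum_powerset_survivorWeight p (Finset.univ : Finset (Fin N))

lemma prob_eq_sum_ite (p : ℝ) (E : Finset (Fin N) → Prop) [DecidablePred E] :
    prob p E = ∑ F : Finset (Fin N), if E F then survivorWeight p F else 0 := by
  rw [prob, Finset.sum_filter]
  exact Finset.sum_congr rfl fun F _ => by by_cases h : E F <;> simp [h]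

lemma prob_disjoint (p : ℝ) (W : Finset (Fin N)) : prob p (fun F => Disjoint F W) = p ^ W.card := by
  have hfilter : ({F | Disjoint F W} : Finset (Finset (Fin N))) = Wᶜ.powerset := by
    ext F
    simp [Finset.subset_compl_iff_disjoint_right]
  rw [prob_eq_sum_ite, ← Finset.sum_filter, hfilter, sum_powerset_survivorWeight,
    Finset.card_compl, Fintype.card_fin, Nat.sub_sub_self (card_finset_fin_le W)]

lemma prob_add_prob_not (p : ℝ) (E : Finset (Fin N) → Prop) :
    prob p E + prob p (fun F => ¬ E F) = 1 := by
  classical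
  rw [← sum_survivorWeight p N, prob_eq_sum_ite, prob_eq_sum_ite, ← Finset.sum_add_distrib]
  exact Finset.sum_congr rfl fun F _ => by by_cases h : E F <;> simp [h]

lemma prob_mono (hp0 : 0 ≤ p) (hp1 : p ≤ 1) {E E' : Finset (Fin N) → Prop}
    (h : ∀ F, E F → E' F) : prob p E ≤ prob p E' := by
  classical
  exact Finset.sum_le_sum_of_subset_of_nonneg (Finset.monotone_filter_right _ fun F _ => h F)
    fun F _ _ => survivorWeight_nonneg hp0 hp1 F

lemma prob_exists_le_sum (hp0 : 0 ≤ p) (hp1 : p ≤ 1) {ι : Type*} (s : Finset ι)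
    (E : ι → Finset (Fin N) → Prop) :
    prob p (fun F => ∃ i ∈ s, E i F) ≤ ∑ i ∈ s, prob p (E i) := by
  classical
  simp only [prob_eq_sum_ite]
  rw [Finset.sum_comm]
  refine Finset.sum_le_sum fun F _ => ?_
  have hterm : ∀ i ∈ s, 0 ≤ if E i F then survivorWeight p F else 0 := fun i _ => by
    split_ifs
    exacts [survivorWeight_nonneg hp0 hp1 F, le_rfl]
  split_ifs with h
  · obtain ⟨i, hi, hE⟩ := h
    simpa [hE] using Finset.single_le_sum hterm hi
  · exact Finset.sum_nonneg hterm

lemma expect_le_add_mul_prob_not (hp0 : 0 ≤ p) (hp1 : p ≤ 1) {X : Finset (Fin N) → ℝ}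
    {E : Finset (Fin N) → Prop} {a b : ℝ} (hgood : ∀ F, E F → X F ≤ a) (hall : ∀ F, X F ≤ a + b) :
    expect p X ≤ a + b * prob p (fun F => ¬ E F) := by
  classical
  have hpoint : ∀ F, survivorWeight p F * X F ≤
      survivorWeight p F * a + b * if ¬ E F then survivorWeight p F else 0 := by
    intro F
    have hw := survivorWeight_nonneg hp0 hp1 F
    by_cases hE : E F
    · simpa [hE] using mul_le_mul_of_nonneg_left (hgood F hE) hw
    · simpa [hE, mul_add, mul_comm b] using mul_le_mul_of_nonneg_left (hall F) hw
  calc expect p X ≤ ∑ F : Finset (Fin N), (survivorWeight p F * a +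
        b * if ¬ E F then survivorWeight p F else 0) := Finset.sum_le_sum fun F _ => hpoint F
    _ = a + b * prob p (fun F => ¬ E F) := by
      rw [Finset.sum_add_distrib, ← Finset.sum_mul, sum_survivorWeight, one_mul,
        ← Finset.mul_sum, ← prob_eq_sum_ite]

/-- `F` meets every window of `R` consecutive indices, that is, no `R` consecutive servers are all
stragglers. This is the event on which the decoders are accurate. -/
def NoLongGap (R : ℕ) (F : Finset (Fin N)) : Prop :=
  ∀ m : ℕ, m + R ≤ N → ∃ v ∈ F, m ≤ (v : ℕ) ∧ (v : ℕ) < m + R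

lemma prob_not_noLongGap_le (hp0 : 0 ≤ p) (hp1 : p ≤ 1) (N : ℕ) {R : ℕ} (hR : 1 ≤ R) :
    prob p (fun F : Finset (Fin N) => ¬ NoLongGap R F) ≤ N * p ^ R := by
  let window : ℕ → Finset (Fin N) := fun m => {v | m ≤ (v : ℕ) ∧ (v : ℕ) < m + R}
  have hcard : ∀ m ∈ Finset.range (N + 1 - R), (window m).card = R := by
    intro m hm
    have hmN : m + R ≤ N := by grind
    have hmap : window m = (Finset.Ico m (m + R)).attachFin (by grind) := by
      ext v
      simp [window]
    rw [hmap, Finset.card_attachFin, Nat.card_Ico, Nat.add_sub_cancel_left]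
  calc prob p (fun F : Finset (Fin N) => ¬ NoLongGap R F)
      ≤ prob p (fun F => ∃ m ∈ Finset.range (N + 1 - R), Disjoint F (window m)) := by
        refine prob_mono hp0 hp1 fun F hF => ?_
        simp only [NoLongGap, not_forall] at hF
        obtain ⟨m, hm, hmiss⟩ := hF
        refine ⟨m, Finset.mem_range.2 (by omega), Finset.disjoint_left.2 fun v hv hvm => ?_⟩
        exact hmiss ⟨v, hv, (Finset.mem_filter.1 hvm).2⟩
    _ ≤ ∑ m ∈ Finset.range (N + 1 - R), prob p (fun F => Disjoint F (window m)) :=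
        prob_exists_le_sum hp0 hp1 _ _
    _ = ((N + 1 - R : ℕ) : ℝ) * p ^ R := by
        rw [Finset.sum_congr rfl fun m hm => by rw [prob_disjoint, hcard m hm], Finset.sum_const,
          Finset.card_range, nsmul_eq_mul]
    _ ≤ N * p ^ R := by
        gcongr
        omega

lemma NoLongGap.exists_mem_Ioc {R : ℕ} {F : Finset (Fin N)} (hF : NoLongGap R F) {t : ℝ}
    (ht0 : 0 ≤ t) (ht : t + R + 1 ≤ N) : ∃ v ∈ F, (v : ℝ) ∈ Ioc t (t + R) := by
  have hfloor := Nat.floor_le ht0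
  have hfit : ⌊t⌋₊ + 1 + R ≤ N := by
    have : ((⌊t⌋₊ + 1 + R : ℕ) : ℝ) ≤ N := by
      push_cast
      linarith
    exact_mod_cast this
  obtain ⟨v, hv, hlo, hhi⟩ := hF _ hfit
  refine ⟨v, hv, (Nat.floor_lt ht0).1 hlo, ?_⟩
  have : ((v : ℕ) : ℝ) ≤ (⌊t⌋₊ + R : ℕ) := by
    exact_mod_cast (by omega : (v : ℕ) ≤ ⌊t⌋₊ + R)
  push_cast at this
  linarith

end Stragglers

section Window

variable {p : ℝ}

/-- The window length `⌈7 log_{1/p} N⌉`. The factor `7` makes the probability that some window of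
this length consists of stragglers at most `N · N⁻⁷ = N⁻⁶`, which outweighs the crude bound
`O(N⁴)` for the error of Berrut's interpolant. -/
noncomputable def windowLength (p : ℝ) (N : ℕ) : ℕ := ⌈7 * logb (1 / p) N⌉₊

lemma windowLength_le {N : ℕ} (hN : 1 ≤ logb (1 / p) N) :
    (windowLength p N : ℝ) ≤ 8 * logb (1 / p) N := by
  have := Nat.ceil_lt_add_one (a := 7 * logb (1 / p) N) (by linarith)
  rw [windowLength]
  linarith

lemma one_le_windowLength {N : ℕ} (hN : 1 ≤ logb (1 / p) N) : 1 ≤ windowLength p N :=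
  Nat.one_le_ceil_iff.2 (by linarith)

lemma mul_pow_windowLength_le (hp0 : 0 < p) (hp1 : p < 1) {N : ℕ} (hN : 1 ≤ N) :
    (N : ℝ) * p ^ windowLength p N ≤ ((N : ℝ) ^ 6)⁻¹ := by
  have hN' : (0 : ℝ) < N := by exact_mod_cast hN
  have hpow : p ^ windowLength p N ≤ ((N : ℝ) ^ 7)⁻¹ := by
    calc p ^ windowLength p N = p ^ (windowLength p N : ℝ) := (rpow_natCast _ _).symm
      _ ≤ p ^ (7 * logb (1 / p) N) := rpow_le_rpow_of_exponent_ge hp0 hp1.le (Nat.le_ceil _)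
      _ = (p ^ logb p N) ^ (-(7 : ℕ) : ℝ) := by
          rw [← rpow_mul hp0.le, one_div, logb_inv_base]
          congr 1
          push_cast
          ring
      _ = ((N : ℝ) ^ 7)⁻¹ := by
          rw [rpow_logb hp0 hp1.ne hN', rpow_neg hN'.le, rpow_natCast]
  calc (N : ℝ) * p ^ windowLength p N ≤ N * ((N : ℝ) ^ 7)⁻¹ := by gcongr
    _ = ((N : ℝ) ^ 6)⁻¹ := by field_simp

lemma eventually_one_le_logb (hp0 : 0 < p) (hp1 : p < 1) :
    ∀ᶠ N : ℕ in atTop, 1 ≤ logb (1 / p) N :=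
  ((tendsto_logb_atTop ((one_lt_div hp0).2 hp1)).comp
    tendsto_natCast_atTop_atTop).eventually_ge_atTop 1

lemma eventually_prob_not_noLongGap_le (hp0 : 0 < p) (hp1 : p < 1) :
    ∀ᶠ N : ℕ in atTop,
      prob p (fun F : Finset (Fin N) => ¬ NoLongGap (windowLength p N) F) ≤ ((N : ℝ) ^ 6)⁻¹ := by
  filter_upwards [eventually_one_le_logb hp0 hp1, eventually_ge_atTop 1] with N hlog hN
  exact (prob_not_noLongGap_le hp0.le hp1.le N (one_le_windowLength hlog)).trans
    (mul_pow_windowLength_le hp0 hp1 hN)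

lemma eventually_expect_le (hp0 : 0 < p) (hp1 : p < 1) :
    ∀ᶠ N : ℕ in atTop, ∀ (X : Finset (Fin N) → ℝ) (a b : ℝ), 0 ≤ b →
      (∀ F, NoLongGap (windowLength p N) F → X F ≤ a) → (∀ F, X F ≤ a + b) →
      expect p X ≤ a + b * ((N : ℝ) ^ 6)⁻¹ := by
  filter_upwards [eventually_prob_not_noLongGap_le hp0 hp1] with N hN X a b hb hgood hall
  calc expect p X ≤ a + b * prob p (fun F => ¬ NoLongGap (windowLength p N) F) :=
        expect_le_add_mul_prob_not hp0.le hp1.le hgood hall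
    _ ≤ a + b * ((N : ℝ) ^ 6)⁻¹ := by gcongr

lemma eventually_le_prob_le (hp0 : 0 < p) (hp1 : p < 1) {δ : ℝ} (hδ : 0 < δ) :
    ∀ᶠ N : ℕ in atTop, ∀ (X : Finset (Fin N) → ℝ) (a : ℝ),
      (∀ F, NoLongGap (windowLength p N) F → X F ≤ a) → 1 - δ ≤ prob p (fun F => X F ≤ a) := by
  have hlim : Tendsto (fun N : ℕ => ((N : ℝ) ^ 6)⁻¹) atTop (𝓝 0) :=
    ((tendsto_pow_atTop (by norm_num)).comp tendsto_natCast_atTop_atTop).inv_tendsto_atTop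
  filter_upwards [eventually_prob_not_noLongGap_le hp0 hp1, hlim.eventually_le_const hδ]
    with N hbad hsmall X a hgood
  have htotal := prob_add_prob_not p (fun F : Finset (Fin N) => NoLongGap (windowLength p N) F)
  exact le_trans (by linarith) (prob_mono hp0.le hp1.le hgood)

end Window

section ChebyshevPoints

lemma sin_le_sin_of_mem_Icc {θ t : ℝ} (hθ : 0 ≤ θ) (ht : t ∈ Icc θ (π - θ)) : sin θ ≤ sin t := by
  rcases le_total t (π / 2) with h | h
  · exact sin_le_sin_of_le_of_le_pi_div_two (by linarith [pi_pos]) h ht.1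
  · rw [← sin_pi_sub t]
    exact sin_le_sin_of_le_of_le_pi_div_two (by linarith [pi_pos]) (by linarith)
      (by linarith [ht.2])

lemma two_mul_sin_mul_le_cos_sub_cos {a b : ℝ} (ha : 0 ≤ a) (hab : a ≤ b) (hb : b ≤ π) :
    2 * sin ((a + b) / 2) * ((b - a) / π) ≤ cos a - cos b := by
  have hsin : (b - a) / π ≤ sin ((b - a) / 2) :=
    calc (b - a) / π = 2 / π * ((b - a) / 2) := by ring
      _ ≤ sin ((b - a) / 2) := mul_le_sin (by linarith) (by linarith)
  have hmid : 0 ≤ sin ((a + b) / 2) := sin_nonneg_of_nonneg_of_le_pi (by linarith) (by linarith)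
  calc 2 * sin ((a + b) / 2) * ((b - a) / π)
      ≤ 2 * sin ((a + b) / 2) * sin ((b - a) / 2) := by gcongr
    _ = cos a - cos b := by
      rw [cos_sub_cos, show (a - b) / 2 = -((b - a) / 2) by ring, sin_neg]
      ring

lemma two_mul_sin_mul_le_cos_sub_cos_of_mem_Icc {a b θ : ℝ} (hθ : 0 ≤ θ) (ha : θ ≤ a)
    (hab : a ≤ b) (hb : b ≤ π - θ) : 2 * sin θ * ((b - a) / π) ≤ cos a - cos b := by
  have : 0 ≤ (b - a) / π := div_nonneg (by linarith) pi_pos.le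
  calc 2 * sin θ * ((b - a) / π) ≤ 2 * sin ((a + b) / 2) * ((b - a) / π) := by
        gcongr
        exact sin_le_sin_of_mem_Icc hθ ⟨by linarith, by linarith⟩
    _ ≤ cos a - cos b := two_mul_sin_mul_le_cos_sub_cos (hθ.trans ha) hab (by linarith)

lemma two_mul_sq_le_cos_sub_cos {a b : ℝ} (ha : 0 ≤ a) (hab : a ≤ b) (hb : b ≤ π) :
    2 * ((b - a) / π) ^ 2 ≤ cos a - cos b := by
  have : 0 ≤ (b - a) / π := div_nonneg (by linarith) pi_pos.le
  have hsin : (b - a) / π ≤ sin ((a + b) / 2) :=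
    calc (b - a) / π = 2 / π * ((b - a) / 2) := by ring
      _ ≤ sin ((b - a) / 2) := mul_le_sin (by linarith) (by linarith)
      _ ≤ sin ((a + b) / 2) := sin_le_sin_of_mem_Icc (by linarith) ⟨by linarith, by linarith⟩
  calc 2 * ((b - a) / π) ^ 2 = 2 * ((b - a) / π) * ((b - a) / π) := by ring
    _ ≤ 2 * sin ((a + b) / 2) * ((b - a) / π) := by gcongr
    _ ≤ cos a - cos b := two_mul_sin_mul_le_cos_sub_cos ha hab hb

/-- The angle of an encoder point, so that `encPoint K k = cos (encAngle K k)`. -/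
noncomputable def encAngle (K : ℕ) (k : Fin K) : ℝ := (2 * (k : ℝ) + 1) * π / (2 * K)

lemma encAngle_mem_Icc {K : ℕ} (k : Fin K) :
    encAngle K k ∈ Icc (π / (2 * K)) (π - π / (2 * K)) := by
  have hK : 0 < (K : ℝ) := by exact_mod_cast k.pos
  have hk : ((k : ℕ) : ℝ) + 1 ≤ K := by exact_mod_cast k.2
  have hπ := pi_pos
  constructor
  · rw [encAngle]
    gcongr
    nlinarith [Nat.cast_nonneg (α := ℝ) (k : ℕ)]
  · rw [encAngle, le_sub_iff_add_le, ← add_div, div_le_iff₀ (by positivity)]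
    nlinarith

lemma encAngle_mem_Icc_zero_pi {K : ℕ} (k : Fin K) : encAngle K k ∈ Icc 0 π := by
  have hK : 0 ≤ π / (2 * K) := by positivity
  exact Icc_subset_Icc hK (by linarith) (encAngle_mem_Icc k)

lemma encPoint_strictAnti (K : ℕ) : StrictAnti (encPoint K) := by
  intro i j hij
  have hK : 0 < (K : ℝ) := by exact_mod_cast i.pos
  have hcast : ((i : ℕ) : ℝ) < ((j : ℕ) : ℝ) := by exact_mod_cast hij
  refine strictAntiOn_cos (encAngle_mem_Icc_zero_pi i) (encAngle_mem_Icc_zero_pi j) ?_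
  simp only [encAngle]
  gcongr

lemma encPoint_mem_Icc {K : ℕ} (k : Fin K) : encPoint K k ∈ Icc (-1 : ℝ) 1 :=
  cos_mem_Icc _

/-- The angle `π / (N - 1)` between consecutive decoder points. -/
noncomputable def decStep (N : ℕ) : ℝ := π / ((N : ℝ) - 1)

lemma decPoint_eq_cos {N : ℕ} (n : Fin N) : decPoint N n = cos (n * decStep N) := by
  rw [decPoint, decStep, mul_div_assoc]

lemma decPoint_mem_Icc {N : ℕ} (n : Fin N) : decPoint N n ∈ Icc (-1 : ℝ) 1 :=
  cos_mem_Icc _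

variable {N : ℕ}

lemma cast_sub_one_pos (hN : 2 ≤ N) : 0 < (N : ℝ) - 1 := by
  have : (2 : ℝ) ≤ N := by exact_mod_cast hN
  linarith

lemma decStep_pos (hN : 2 ≤ N) : 0 < decStep N :=
  div_pos pi_pos (cast_sub_one_pos hN)

lemma sub_one_mul_decStep (hN : 2 ≤ N) : ((N : ℝ) - 1) * decStep N = π :=
  mul_div_cancel₀ _ (cast_sub_one_pos hN).ne'

lemma mul_decStep_mem_Icc (hN : 2 ≤ N) (n : Fin N) : (n : ℝ) * decStep N ∈ Icc 0 π := by
  have hn : ((n : ℕ) : ℝ) + 1 ≤ N := by exact_mod_cast n.2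
  have hstep := decStep_pos hN
  refine ⟨by positivity, ?_⟩
  rw [← sub_one_mul_decStep hN]
  gcongr
  linarith

lemma add_one_mul_decStep_le {m n : Fin N} (hN : 2 ≤ N) (h : m < n) :
    (m : ℝ) * decStep N + decStep N ≤ n * decStep N := by
  have hcast : ((m : ℕ) : ℝ) + 1 ≤ (n : ℕ) := by exact_mod_cast h
  nlinarith [decStep_pos hN]

lemma le_decPoint_sub (hN : 2 ≤ N) {m n : Fin N} (h : m < n) :
    2 / ((N : ℝ) - 1) ^ 2 ≤ decPoint N m - decPoint N n := by
  have hN1 := cast_sub_one_pos hN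
  have hstep := decStep_pos hN
  have hmn := add_one_mul_decStep_le hN h
  calc 2 / ((N : ℝ) - 1) ^ 2 = 2 * (decStep N / π) ^ 2 := by
        rw [decStep]
        field_simp
    _ ≤ 2 * ((n * decStep N - m * decStep N) / π) ^ 2 := by
        gcongr
        linarith
    _ ≤ decPoint N m - decPoint N n := by
        rw [decPoint_eq_cos, decPoint_eq_cos]
        exact two_mul_sq_le_cos_sub_cos (mul_decStep_mem_Icc hN m).1 (by linarith)
          (mul_decStep_mem_Icc hN n).2

lemma decPoint_strictAnti (hN : 2 ≤ N) : StrictAnti (decPoint N) := fun _ _ h =>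
  sub_pos.1 ((div_pos two_pos (pow_pos (cast_sub_one_pos hN) 2)).trans_le (le_decPoint_sub hN h))

lemma two_mul_sin_div_le_decPoint_sub (hN : 2 ≤ N) {m n : Fin N} (hmn : m < n) {θ : ℝ}
    (hθ : 0 ≤ θ) (hm : θ ≤ m * decStep N) (hm' : m * decStep N + decStep N ≤ π - θ) :
    2 * sin θ * (decStep N / π) ≤ decPoint N m - decPoint N n := by
  have hstep := decStep_pos hN
  have hnext : cos (n * decStep N) ≤ cos (m * decStep N + decStep N) :=
    cos_le_cos_of_nonneg_of_le_pi (by linarith) (mul_decStep_mem_Icc hN n).2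
      (add_one_mul_decStep_le hN hmn)
  have hgap := two_mul_sin_mul_le_cos_sub_cos_of_mem_Icc hθ hm
    (le_add_of_nonneg_right hstep.le) hm'
  rw [add_sub_cancel_left] at hgap
  rw [decPoint_eq_cos, decPoint_eq_cos]
  linarith

lemma NoLongGap.exists_angle_mem_Ioc (hN : 2 ≤ N) {R : ℕ} {F : Finset (Fin N)}
    (hF : NoLongGap R F) {θ : ℝ} (hθ : 0 ≤ θ) (hθπ : θ + R * decStep N ≤ π) :
    ∃ v ∈ F, (v : ℝ) * decStep N ∈ Ioc θ (θ + R * decStep N) := by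
  have hstep := decStep_pos hN
  have hfit : θ / decStep N + R + 1 ≤ N := by
    have : (θ / decStep N + R) * decStep N ≤ (N - 1) * decStep N := by
      rwa [add_mul, div_mul_cancel₀ _ hstep.ne', sub_one_mul_decStep hN]
    linarith [le_of_mul_le_mul_right this hstep]
  obtain ⟨v, hv, hlo, hhi⟩ := hF.exists_mem_Ioc (div_nonneg hθ hstep.le) hfit
  refine ⟨v, hv, (div_lt_iff₀ hstep).1 hlo, ?_⟩
  calc (v : ℝ) * decStep N ≤ (θ / decStep N + R) * decStep N := by gcongr
    _ = θ + R * decStep N := by rw [add_mul, div_mul_cancel₀ _ hstep.ne']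

lemma windowLength_add_one_mul_decStep_le {p : ℝ} (hN : 2 ≤ N) (hlog : 1 ≤ logb (1 / p) N) :
    ((windowLength p N : ℝ) + 1) * decStep N ≤ 18 * π * (logb (1 / p) N / N) := by
  have hN' : (2 : ℝ) ≤ N := by exact_mod_cast hN
  have hlen : (windowLength p N : ℝ) + 1 ≤ 9 * logb (1 / p) N := by
    linarith [windowLength_le hlog]
  have hstep : decStep N ≤ π / (N / 2) := by
    rw [decStep]
    gcongr
    linarith
  calc ((windowLength p N : ℝ) + 1) * decStep N ≤ 9 * logb (1 / p) N * (π / (N / 2)) :=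
        mul_le_mul hlen hstep (decStep_pos hN).le (by linarith)
    _ = 18 * π * (logb (1 / p) N / N) := by ring

lemma tendsto_windowLength_add_one_mul_decStep {p : ℝ} (hp0 : 0 < p) (hp1 : p < 1) :
    Tendsto (fun N : ℕ => ((windowLength p N : ℝ) + 1) * decStep N) atTop (𝓝 0) := by
  have hlog : Tendsto (fun N : ℕ => logb (1 / p) N / N) atTop (𝓝 0) := by
    have h := (isLittleO_log_id_atTop.tendsto_div_nhds_zero.comp
      tendsto_natCast_atTop_atTop).div_const (log (1 / p))
    rw [zero_div] at h
    exact h.congr fun N => div_right_comm _ _ _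
  have hbound := hlog.const_mul (18 * π)
  rw [mul_zero] at hbound
  refine squeeze_zero' ?_ ?_ hbound
  · filter_upwards [eventually_ge_atTop 2] with N hN
    have := decStep_pos hN
    positivity
  · filter_upwards [eventually_ge_atTop 2, eventually_one_le_logb hp0 hp1] with N hN hlog
    exact windowLength_add_one_mul_decStep_le hN hlog

end ChebyshevPoints

section Spacing

variable {N : ℕ}

lemma decPointWithEnds_succ {n : ℕ} (hn : n < N) :
    decPointWithEnds N (n + 1) = cos (n * decStep N) := by
  simp only [decPointWithEnds, Nat.add_eq_zero_iff, one_ne_zero, and_false, if_false,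
    Nat.add_sub_cancel, hn, dif_pos, decPoint_eq_cos]

lemma decPointWithEnds_last (hN : 2 ≤ N) : decPointWithEnds N N = -1 := by
  obtain ⟨n, rfl⟩ : ∃ n, N = n + 1 := ⟨N - 1, by omega⟩
  rw [decPointWithEnds_succ n.lt_succ_self, ← cos_pi, ← sub_one_mul_decStep hN]
  push_cast
  rw [add_sub_cancel_right]

lemma abs_decPointWithEnds_sub_le (hN : 2 ≤ N) (n : Fin (N + 1)) :
    |decPointWithEnds N (n + 1) - decPointWithEnds N n| ≤ decStep N := by
  have hstep := decStep_pos hN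
  obtain ⟨n, hn⟩ := n
  rcases Nat.eq_zero_or_pos n with rfl | hn0
  · rw [decPointWithEnds_succ (n := 0) (by omega)]
    simpa [decPointWithEnds] using hstep.le
  obtain ⟨m, rfl⟩ : ∃ m, n = m + 1 := ⟨n - 1, by omega⟩
  rcases (Nat.le_of_lt_succ hn).lt_or_eq with hm | hm
  · rw [decPointWithEnds_succ hm, decPointWithEnds_succ (by omega)]
    refine (abs_cos_sub_cos_le _ _).trans (le_of_eq ?_)
    push_cast
    rw [← sub_mul, add_sub_cancel_left, one_mul, abs_of_pos hstep]
  · have hend : decPointWithEnds N (N + 1) = -1 := by simp [decPointWithEnds]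
    simpa [hm, hend, decPointWithEnds_last hN] using hstep.le

lemma maxGap_le (hN : 2 ≤ N) : maxGap N ≤ decStep N :=
  ciSup_le (abs_decPointWithEnds_sub_le hN)

lemma le_maxGap (hN : 2 ≤ N) : 2 / ((N : ℝ) - 1) ≤ maxGap N := by
  have hbdd : BddAbove (range fun n : Fin (N + 1) =>
      |decPointWithEnds N (n + 1) - decPointWithEnds N n|) := (Set.finite_range _).bddAbove
  have hgap : ∀ i ∈ Finset.range (N - 1),
      decPointWithEnds N (i + 1) - decPointWithEnds N (i + 1 + 1) ≤ maxGap N := by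
    intro i hi
    have hiN : i + 1 < N + 1 := by grind
    refine le_trans ?_ (le_ciSup hbdd ⟨i + 1, hiN⟩)
    rw [abs_sub_comm]
    exact le_abs_self _
  have htotal : 2 ≤ ((N : ℝ) - 1) * maxGap N := by
    have hfirst : decPointWithEnds N 1 = 1 := by
      simpa using decPointWithEnds_succ (N := N) (n := 0) (by omega)
    have := Finset.sum_le_sum hgap
    rw [Finset.sum_range_sub' (fun i => decPointWithEnds N (i + 1)), Nat.sub_add_cancel (by omega),
      decPointWithEnds_last hN, zero_add, hfirst, Finset.sum_const, Finset.card_range,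
      nsmul_eq_mul, Nat.cast_sub (by omega), Nat.cast_one] at this
    linarith
  rwa [div_le_iff₀' (cast_sub_one_pos hN)]

lemma le_minGap (hN : 2 ≤ N) : 2 / ((N : ℝ) - 1) ^ 2 ≤ minGap N := by
  have : Nonempty (Fin (N - 1)) := ⟨⟨0, by omega⟩⟩
  refine le_ciInf fun n => ?_
  have hgap := le_decPoint_sub hN (m := ⟨n, by omega⟩) (n := ⟨n + 1, by omega⟩) (by simp)
  rw [decPoint_eq_cos, decPoint_eq_cos] at hgap
  rw [decPointWithEnds_succ (n := n + 1) (by omega), decPointWithEnds_succ (by omega), abs_sub_comm]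
  exact hgap.trans (le_abs_self _)

lemma minGap_le (hN : 2 ≤ N) : minGap N ≤ decStep N ^ 2 / 2 := by
  have hbdd : BddBelow (range fun n : Fin (N - 1) =>
      |decPointWithEnds N (n + 2) - decPointWithEnds N (n + 1)|) := (Set.finite_range _).bddBelow
  refine (ciInf_le hbdd ⟨0, by omega⟩).trans ?_
  have hfirst : |decPointWithEnds N (0 + 1 + 1) - decPointWithEnds N (0 + 1)| =
      1 - cos (decStep N) := by
    rw [decPointWithEnds_succ (n := 0 + 1) (by omega), decPointWithEnds_succ (n := 0) (by omega),
      abs_sub_comm, Nat.cast_zero, zero_mul, cos_zero, Nat.zero_add, Nat.cast_one, one_mul,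
      abs_of_nonneg (by linarith [cos_le_one (decStep N)])]
  exact hfirst.trans_le (by linarith [one_sub_sq_div_two_le_cos (x := decStep N)])

lemma maxGap_div_minGap_isBigO :
    (fun N : ℕ => maxGap N / minGap N) =O[atTop] (fun N : ℕ => (N : ℝ)) := by
  refine Asymptotics.IsBigO.of_bound (π / 2) ?_
  filter_upwards [eventually_ge_atTop 2] with N hN
  have hN1 := cast_sub_one_pos hN
  have hmin : 0 < minGap N := lt_of_lt_of_le (by positivity) (le_minGap hN)
  have hmax : 0 < maxGap N := lt_of_lt_of_le (by positivity) (le_maxGap hN)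
  rw [norm_of_nonneg (by positivity), norm_of_nonneg (by positivity)]
  calc maxGap N / minGap N ≤ decStep N / (2 / ((N : ℝ) - 1) ^ 2) :=
        div_le_div₀ (decStep_pos hN).le (maxGap_le hN) (by positivity) (le_minGap hN)
    _ = π / 2 * ((N : ℝ) - 1) := by
        rw [decStep]
        field_simp
    _ ≤ π / 2 * N := by
        gcongr
        linarith

lemma tendsto_maxGap_div_minGap :
    Tendsto (fun N : ℕ => maxGap N / minGap N) atTop atTop := by
  have hlinear : Tendsto (fun N : ℕ => 4 / π ^ 2 * ((N : ℝ) + (-1))) atTop atTop :=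
    (tendsto_atTop_add_const_right _ _ tendsto_natCast_atTop_atTop).const_mul_atTop (by positivity)
  refine tendsto_atTop_mono' _ ?_ hlinear
  filter_upwards [eventually_ge_atTop 2] with N hN
  have hN1 := cast_sub_one_pos hN
  have hmin : 0 < minGap N := lt_of_lt_of_le (by positivity) (le_minGap hN)
  have hmax : 0 < maxGap N := lt_of_lt_of_le (by positivity) (le_maxGap hN)
  calc 4 / π ^ 2 * ((N : ℝ) + (-1)) = (2 / ((N : ℝ) - 1)) / (decStep N ^ 2 / 2) := by
        rw [decStep, ← sub_eq_add_neg]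
        field_simp
        ring
    _ ≤ maxGap N / minGap N := div_le_div₀ hmax.le (le_maxGap hN) hmin (minGap_le hN)

end Spacing

section AlternatingSums

variable {n : ℕ} {s : Finset (Fin n)} {w : Fin n → ℝ}

/-- The alternating sum `w i₀ - w i₁ + w i₂ - ⋯` over the elements `i₀ < i₁ < i₂ < ⋯` of `s`.
Both the numerator and the denominator of Berrut's interpolant are of this form. -/
noncomputable def altSum (s : Finset (Fin n)) (w : Fin n → ℝ) : ℝ :=
  ∑ i ∈ s, berrutSign s i * w i

lemma altSum_union {A B : Finset (Fin n)} (h : ∀ i ∈ A, ∀ j ∈ B, i < j) (w : Fin n → ℝ) :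
    altSum (A ∪ B) w = altSum A w + (-1) ^ A.card * altSum B w := by
  have hAB : Disjoint A B := Finset.disjoint_left.2 fun i hi hj => lt_irrefl _ (h i hi i hj)
  rw [altSum, Finset.sum_union hAB, altSum, altSum, Finset.mul_sum]
  congr 1
  · refine Finset.sum_congr rfl fun i hi => ?_
    have hbelow : (A ∪ B).filter (· < i) = A.filter (· < i) := by
      grind [lt_asymm]
    rw [berrutSign, hbelow, berrutSign]
  · refine Finset.sum_congr rfl fun i hi => ?_
    have hbelow : (A ∪ B).filter (· < i) = A ∪ B.filter (· < i) := by
      grind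
    rw [berrutSign, hbelow, Finset.card_union_of_disjoint
      (hAB.mono_right (Finset.filter_subset _ _)), pow_add, berrutSign, mul_assoc]

lemma altSum_insert_min {m : Fin n} (h : ∀ i ∈ s, m < i) (w : Fin n → ℝ) :
    altSum (insert m s) w = w m - altSum s w := by
  have hsingle : altSum {m} w = w m := by
    simp [altSum, berrutSign, Finset.filter_singleton]
  rw [Finset.insert_eq, altSum_union (by simpa using h), hsingle, Finset.card_singleton, pow_one,
    neg_one_mul, sub_eq_add_neg]

lemma altSum_image_rev (s : Finset (Fin n)) (w : Fin n → ℝ) :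
    altSum (s.image Fin.rev) w = (-1) ^ (s.card + 1) * altSum s (w ∘ Fin.rev) := by
  rw [altSum, Finset.sum_image Fin.rev_injective.injOn, altSum, Finset.mul_sum]
  refine Finset.sum_congr rfl fun i hi => ?_
  have habove : (s.image Fin.rev).filter (· < i.rev) = (s.filter (i < ·)).image Fin.rev := by
    ext j
    simp only [Finset.mem_filter, Finset.mem_image]
    exact ⟨fun ⟨⟨k, hk, hkj⟩, hj⟩ => ⟨k, ⟨hk, Fin.rev_lt_rev.1 (hkj ▸ hj)⟩, hkj⟩,
      fun ⟨k, ⟨hk, hik⟩, hkj⟩ => ⟨⟨k, hk, hkj⟩, hkj ▸ Fin.rev_lt_rev.2 hik⟩⟩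
  have hcard : s.card = (s.filter (· < i)).card + 1 + (s.filter (i < ·)).card := by
    rw [← Finset.card_filter_add_card_filter_not (s := s) (· < i), add_assoc]
    congr 1
    have hge : s.filter (¬ · < i) = insert i (s.filter (i < ·)) := by
      ext j
      grind
    rw [hge, Finset.card_insert_of_notMem (by simp), add_comm]
  have hsign : berrutSign (s.image Fin.rev) i.rev = (-1) ^ (s.card + 1) * berrutSign s i := by
    rw [berrutSign, habove, Finset.card_image_of_injective _ Fin.rev_injective, hcard, berrutSign,
      ← pow_add]
    exact (neg_one_pow_congr (by grind)).symm
  rw [hsign, mul_assoc, Function.comp_apply]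

lemma altSum_mem_Icc_of_antitoneOn {c : ℝ} (hw : AntitoneOn w s) (hc : 0 ≤ c)
    (hwc : ∀ i ∈ s, w i ∈ Icc 0 c) : altSum s w ∈ Icc 0 c := by
  induction s using Finset.induction_on_min generalizing c with
  | empty => simpa [altSum] using hc
  | insert m s hm ih =>
    obtain ⟨hm0, hmc⟩ := hwc m (Finset.mem_insert_self m s)
    have htail : altSum s w ∈ Icc 0 (w m) :=
      ih (hw.mono (by simp)) hm0 fun i hi =>
        ⟨(hwc i (by simp [hi])).1, hw (by simp) (by simp [hi]) (hm i hi).le⟩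
    rw [altSum_insert_min hm]
    exact ⟨by linarith [htail.2], by linarith [htail.1]⟩

lemma neg_one_pow_mul_altSum_nonneg (hw : AntitoneOn w s) (hw0 : ∀ i ∈ s, w i ≤ 0) :
    0 ≤ (-1) ^ s.card * altSum s w := by
  have hreflect := altSum_image_rev s fun i => -w i.rev
  have hneg : altSum s ((fun i => -w i.rev) ∘ Fin.rev) = -altSum s w := by
    simp [altSum, Finset.sum_neg_distrib]
  rw [hneg, pow_succ, mul_neg_one, neg_mul_neg] at hreflect
  rw [← hreflect]
  refine (altSum_mem_Icc_of_antitoneOn (c := ∑ i ∈ s, -w i) ?_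
    (Finset.sum_nonneg fun i hi => neg_nonneg.2 (hw0 i hi)) ?_).1
  · intro i hi j hj hij
    obtain ⟨i, his, rfl⟩ := Finset.mem_image.1 hi
    obtain ⟨j, hjs, rfl⟩ := Finset.mem_image.1 hj
    simpa using hw hjs his (Fin.rev_le_rev.1 hij)
  · intro i hi
    obtain ⟨i, his, rfl⟩ := Finset.mem_image.1 hi
    have hterm := Finset.single_le_sum (f := fun i => -w i)
      (fun i hi => neg_nonneg.2 (hw0 i hi)) his
    simpa using And.intro (hw0 i his) hterm

lemma sub_le_abs_altSum {v : Fin n} {c : ℝ} (hv : v ∈ s) (hc : 0 ≤ c)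
    (hbelow : AntitoneOn w {i ∈ s | i < v}) (hbelow0 : ∀ i ∈ s, i < v → w i ≤ 0)
    (habove : AntitoneOn w {i ∈ s | v < i}) (habovec : ∀ i ∈ s, v < i → w i ∈ Icc 0 c) :
    w v - c ≤ |altSum s w| := by
  have hsplit : s = s.filter (· < v) ∪ insert v (s.filter (v < ·)) := by
    ext i
    grind
  have hhead : 0 ≤ (-1) ^ (s.filter (· < v)).card * altSum (s.filter (· < v)) w :=
    neg_one_pow_mul_altSum_nonneg (by simpa using hbelow) (by simpa using hbelow0)
  have htail : altSum (s.filter (v < ·)) w ∈ Icc 0 c :=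
    altSum_mem_Icc_of_antitoneOn (by simpa using habove) hc (by simpa using habovec)
  have hsum : (-1) ^ (s.filter (· < v)).card * altSum s w =
      (-1) ^ (s.filter (· < v)).card * altSum (s.filter (· < v)) w +
        (w v - altSum (s.filter (v < ·)) w) := by
    nth_rw 2 [hsplit]
    rw [altSum_union (by grind), altSum_insert_min (by simp), mul_add, ← mul_assoc, ← mul_pow]
    simp
  calc w v - c ≤ (-1) ^ (s.filter (· < v)).card * altSum s w := by
        rw [hsum]
        linarith [htail.2]
    _ ≤ |(-1) ^ (s.filter (· < v)).card * altSum s w| := le_abs_self _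
    _ = |altSum s w| := by simp [abs_mul]

end AlternatingSums

section BerrutDenominator

variable {n : ℕ} {s : Finset (Fin n)} {nodes : Fin n → ℝ} {z a d : ℝ} {v : Fin n}

/-- The denominator `∑ (-1)ⁱ / (z - tᵢ)` of Berrut's interpolant with the nodes `tᵢ`, `i ∈ s`.
Lower bounds for it control the error of the interpolant. -/
noncomputable def berrutDen (s : Finset (Fin n)) (nodes : Fin n → ℝ) (z : ℝ) : ℝ :=
  altSum s fun i => 1 / (z - nodes i)

lemma one_div_sub_one_div_add (ha : 0 < a) (hd : 0 ≤ d) :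
    1 / a - 1 / (a + d) = d / (a * (a + d)) := by
  have : 0 < a + d := by linarith
  field_simp
  ring

-- The terms of `berrutDen` are negative and decreasing up to the node before `v`, and positive and
-- decreasing from `v` on, where the first one exceeds all later ones by `1 / a - 1 / (a + d)`.
lemma div_le_abs_berrutDen_of_largest_lt (hn : StrictAnti nodes) (hv : v ∈ s) (hvz : nodes v < z)
    (hbelow : ∀ i ∈ s, i < v → z < nodes i) (hd : 0 ≤ d)
    (hgap : ∀ j ∈ s, v < j → d ≤ nodes v - nodes j) :
    d / ((z - nodes v) * (z - nodes v + d)) ≤ |berrutDen s nodes z| := by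
  have hvz' : 0 < z - nodes v := sub_pos.2 hvz
  rw [← one_div_sub_one_div_add hvz' hd]
  refine sub_le_abs_altSum (w := fun i => 1 / (z - nodes i)) hv (by positivity) ?_ ?_ ?_ ?_
  · rintro i - j ⟨hj, hjv⟩ hij
    exact one_div_le_one_div_of_neg_of_le (by linarith [hbelow j hj hjv])
      (by linarith [hn.antitone hij])
  · intro i hi hiv
    exact one_div_nonpos.2 (by linarith [hbelow i hi hiv])
  · rintro i ⟨-, hvi⟩ j - hij
    exact one_div_le_one_div_of_le (by linarith [hn hvi]) (by linarith [hn.antitone hij])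
  · intro i hi hvi
    have := hgap i hi hvi
    exact ⟨one_div_nonneg.2 (by linarith [hn hvi]),
      one_div_le_one_div_of_le (by linarith) (by linarith)⟩

lemma div_le_abs_berrutDen_of_lt (hn : StrictAnti nodes) (hz : ∀ i ∈ s, nodes i ≠ z) (hv : v ∈ s)
    (hvz : nodes v < z) (hva : z - nodes v ≤ a) (hd : 0 ≤ d)
    (hsep : ∀ i ∈ s, i ≤ v → nodes i < z → ∀ j ∈ s, i < j → d ≤ nodes i - nodes j) :
    d / (a * (a + d)) ≤ |berrutDen s nodes z| := by
  have hlower : (s.filter (nodes · < z)).Nonempty := ⟨v, Finset.mem_filter.2 ⟨hv, hvz⟩⟩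
  obtain ⟨hms, hmz⟩ := Finset.mem_filter.1 (Finset.min'_mem _ hlower)
  have hmin : ∀ i ∈ s, nodes i < z → Finset.min' _ hlower ≤ i := fun i hi hiz =>
    Finset.min'_le _ i (Finset.mem_filter.2 ⟨hi, hiz⟩)
  generalize Finset.min' _ hlower = m at hms hmz hmin
  have hmv := hmin v hv hvz
  have hma : z - nodes m ≤ a := by linarith [hn.antitone hmv]
  have hm0 : 0 < z - nodes m := sub_pos.2 hmz
  have ha0 : 0 < a := hm0.trans_le hma
  calc d / (a * (a + d)) ≤ d / ((z - nodes m) * (z - nodes m + d)) := by gcongr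
    _ ≤ |berrutDen s nodes z| :=
      div_le_abs_berrutDen_of_largest_lt hn hms hmz
        (fun i hi him => lt_of_le_of_ne (not_lt.1 fun hiz => him.not_ge (hmin i hi hiz))
          (hz i hi).symm)
        hd (hsep m hms hmv hmz)

lemma abs_berrutDen_image_rev (s : Finset (Fin n)) (nodes : Fin n → ℝ) (z : ℝ) :
    |berrutDen (s.image Fin.rev) (fun i => -nodes i.rev) (-z)| = |berrutDen s nodes z| := by
  have hneg : altSum s ((fun i => 1 / (-z - -nodes i.rev)) ∘ Fin.rev) = -berrutDen s nodes z := by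
    rw [berrutDen, altSum, altSum, ← Finset.sum_neg_distrib]
    refine Finset.sum_congr rfl fun i _ => ?_
    rw [Function.comp_apply, Fin.rev_rev, ← neg_sub', one_div_neg_eq_neg_one_div, mul_neg]
  rw [berrutDen, altSum_image_rev, hneg]
  simp [abs_mul]

lemma div_le_abs_berrutDen (hn : StrictAnti nodes) (hz : ∀ i ∈ s, nodes i ≠ z) (hv : v ∈ s)
    (hva : |z - nodes v| ≤ a) (hd : 0 ≤ d)
    (hsep : ∀ i ∈ s, ∀ j ∈ s, i < j → d ≤ nodes i - nodes j) :
    d / (a * (a + d)) ≤ |berrutDen s nodes z| := by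
  rcases (hz v hv).lt_or_gt with hlt | hgt
  · exact div_le_abs_berrutDen_of_lt hn hz hv hlt ((le_abs_self _).trans hva) hd
      fun i hi _ _ => hsep i hi
  · rw [← abs_berrutDen_image_rev]
    refine div_le_abs_berrutDen_of_lt (v := v.rev)
      (fun i j hij => neg_lt_neg (hn (Fin.rev_lt_rev.2 hij))) ?_
      (Finset.mem_image_of_mem _ hv) ?_ ?_ hd ?_
    · simpa using hz
    · simpa using hgt
    · rw [Fin.rev_rev]
      linarith [neg_abs_le (z - nodes v)]
    · intro i hi _ _ j hj hij
      obtain ⟨i, his, rfl⟩ := Finset.mem_image.1 hi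
      obtain ⟨j, hjs, rfl⟩ := Finset.mem_image.1 hj
      rw [Fin.rev_rev, Fin.rev_rev]
      linarith [hsep j hjs i his (Fin.rev_lt_rev.1 hij)]

end BerrutDenominator

section BerrutError

variable {n : ℕ} {s : Finset (Fin n)} {nodes : Fin n → ℝ} {a b B z : ℝ} {L : ℝ≥0}
  {g g' : ℝ → ℝ} {S : Set ℝ}

-- Adding `B + L * (nodes i - a)` makes `w` nonnegative and antitone.
lemma abs_altSum_le (hn : StrictAnti nodes) {w : Fin n → ℝ} (hab : a ≤ b) (hB : 0 ≤ B)
    (hmem : ∀ i ∈ s, nodes i ∈ Icc a b) (hw : ∀ i ∈ s, |w i| ≤ B)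
    (hlip : ∀ i ∈ s, ∀ j ∈ s, |w i - w j| ≤ L * |nodes i - nodes j|) :
    |altSum s w| ≤ 2 * B + L * (b - a) := by
  have hL := L.coe_nonneg
  let shift : Fin n → ℝ := fun i => B + L * (nodes i - a)
  have hshift_anti : Antitone shift := fun i j hij => by
    have := hn.antitone hij
    simp only [shift]
    gcongr
  have hshift_mem : ∀ i ∈ s, shift i ∈ Icc B (B + L * (b - a)) := fun i hi => by
    have hlo := mul_nonneg hL (sub_nonneg.2 (hmem i hi).1)
    have hhi := mul_nonneg hL (sub_nonneg.2 (hmem i hi).2)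
    exact ⟨by simp only [shift]; linarith, by simp only [shift]; linarith⟩
  have hrange := mul_nonneg hL (sub_nonneg.2 hab)
  have hshifted : altSum s (fun i => w i + shift i) ∈ Icc 0 (2 * B + L * (b - a)) := by
    refine altSum_mem_Icc_of_antitoneOn (fun i hi j hj hij => ?_) (by linarith) fun i hi => ?_
    · have hji := (le_abs_self _).trans (hlip j hj i hi)
      rw [abs_of_nonpos (sub_nonpos.2 (hn.antitone hij))] at hji
      simp only [shift]
      linarith
    · obtain ⟨hwlo, hwhi⟩ := abs_le.1 (hw i hi)
      obtain ⟨hlo, hhi⟩ := hshift_mem i hi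
      exact ⟨by linarith, by linarith⟩
  have hshift : altSum s shift ∈ Icc 0 (B + L * (b - a)) :=
    altSum_mem_Icc_of_antitoneOn (hshift_anti.antitoneOn _) (by linarith) fun i hi =>
      ⟨hB.trans (hshift_mem i hi).1, (hshift_mem i hi).2⟩
  have hdiff : altSum s w = altSum s (fun i => w i + shift i) - altSum s shift := by
    simp only [altSum, mul_add, Finset.sum_add_distrib, add_sub_cancel_right]
  rw [hdiff, abs_le]
  exact ⟨by linarith [hshifted.1, hshift.2], by linarith [hshifted.2, hshift.1]⟩

lemma abs_slope_le (hS : Convex ℝ S) (hg : ∀ t ∈ S, HasDerivAt g (g' t) t)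
    (hB : ∀ t ∈ S, |g' t| ≤ B) {t : ℝ} (hz : z ∈ S) (ht : t ∈ S) (htz : t ≠ z) :
    |slope g z t| ≤ B := by
  rw [slope_def_field, abs_div, div_le_iff₀ (abs_pos.2 (sub_ne_zero.2 htz))]
  exact hS.norm_image_sub_le_of_norm_hasDerivWithin_le
    (fun t ht => (hg t ht).hasDerivWithinAt) hB hz ht

-- The slope is the integral of `r ↦ g' (z + r * (t - z))` over `[0, 1]`.
lemma abs_slope_sub_slope_le (hS : Convex ℝ S) (hg : ∀ t ∈ S, HasDerivAt g (g' t) t)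
    (hlip : LipschitzOnWith L g' S) {t₁ t₂ : ℝ} (hz : z ∈ S) (ht₁ : t₁ ∈ S) (ht₂ : t₂ ∈ S)
    (hne₁ : t₁ ≠ z) (hne₂ : t₂ ≠ z) : |slope g z t₁ - slope g z t₂| ≤ L * |t₁ - t₂| := by
  have hmem : ∀ t ∈ S, ∀ r ∈ Icc (0 : ℝ) 1, z + r * (t - z) ∈ S := fun t ht r hr => by
    simpa using hS.add_smul_sub_mem hz ht hr
  have hderiv : ∀ t ∈ S, t ≠ z → ∀ r ∈ Icc (0 : ℝ) 1,
      HasDerivAt (fun r : ℝ => g (z + r * (t - z)) / (t - z)) (g' (z + r * (t - z))) r := by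
    intro t ht htz r hr
    have hline : HasDerivAt (fun r : ℝ => z + r * (t - z)) (1 * (t - z)) r :=
      ((hasDerivAt_id r).mul_const _).const_add _
    have hcomp := ((hg _ (hmem t ht r hr)).comp r hline).div_const (t - z)
    rwa [one_mul, mul_div_assoc, div_self (sub_ne_zero.2 htz), mul_one] at hcomp
  have hmvt := norm_image_sub_le_of_norm_deriv_le_segment_01'
    (f := fun r : ℝ => g (z + r * (t₁ - z)) / (t₁ - z) - g (z + r * (t₂ - z)) / (t₂ - z))
    (C := L * |t₁ - t₂|)
    (fun r hr => ((hderiv t₁ ht₁ hne₁ r hr).sub (hderiv t₂ ht₂ hne₂ r hr)).hasDerivWithinAt)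
    (fun r hr => by
      have hr' : r ∈ Icc (0 : ℝ) 1 := Ico_subset_Icc_self hr
      have hdist := hlip.dist_le_mul _ (hmem t₁ ht₁ r hr') _ (hmem t₂ ht₂ r hr')
      rw [dist_add_left, dist_eq, dist_eq, ← mul_sub, sub_sub_sub_cancel_right, abs_mul,
        abs_of_nonneg hr.1] at hdist
      refine hdist.trans ?_
      gcongr
      exact mul_le_of_le_one_left (abs_nonneg _) hr.2.le)
  simp only [one_mul, zero_mul, add_zero, add_sub_cancel, norm_eq_abs] at hmvt
  rw [slope_def_field, slope_def_field, sub_div, sub_div]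
  convert! hmvt using 2
  ring

lemma exists_deriv_bounds (hg : ContDiff ℝ 2 g) (a b : ℝ) :
    ∃ (B : ℝ) (L : ℝ≥0), (∀ t ∈ Icc a b, |deriv g t| ≤ B) ∧
      LipschitzOnWith L (deriv g) (Icc a b) := by
  have hg' : ContDiff ℝ 1 (deriv g) := by
    rw [show (2 : WithTop ℕ∞) = 1 + 1 by norm_num, contDiff_succ_iff_deriv] at hg
    exact hg.2.2
  obtain ⟨B, hB⟩ := isCompact_Icc.exists_bound_of_continuousOn hg'.continuous.continuousOn
  obtain ⟨L, hL⟩ := hg'.locallyLipschitz.locallyLipschitzOn.exists_lipschitzOnWith_of_compact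
    isCompact_Icc
  exact ⟨B, L, hB, hL⟩

lemma berrut_node (hn : StrictAnti nodes) (y : Fin n → ℝ) {i : Fin n} (hi : i ∈ s) :
    berrut s nodes y (nodes i) = y i := by
  have h : ∃ j ∈ s, nodes j = nodes i := ⟨i, hi, rfl⟩
  rw [berrut, dif_pos h, hn.injective h.choose_spec.2]

lemma berrut_of_ne (hz : ∀ i ∈ s, nodes i ≠ z) (y : Fin n → ℝ) :
    berrut s nodes y z = (altSum s fun i => y i / (z - nodes i)) / berrutDen s nodes z := by
  have hden : ∑ j ∈ s, berrutSign s j / (z - nodes j) = berrutDen s nodes z :=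
    Finset.sum_congr rfl fun i _ => by rw [mul_one_div]
  rw [berrut, dif_neg (by simpa using hz), hden, altSum, Finset.sum_div]
  exact Finset.sum_congr rfl fun i _ => by ring

lemma berrut_sub_eq (hz : ∀ i ∈ s, nodes i ≠ z) (hden : berrutDen s nodes z ≠ 0) (g : ℝ → ℝ) :
    berrut s nodes (fun i => g (nodes i)) z - g z =
      -(altSum s fun i => slope g z (nodes i)) / berrutDen s nodes z := by
  rw [berrut_of_ne hz, div_sub' hden]
  congr 1
  rw [berrutDen, altSum, altSum, altSum, Finset.sum_mul, ← Finset.sum_sub_distrib,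
    ← Finset.sum_neg_distrib]
  refine Finset.sum_congr rfl fun i _ => ?_
  rw [slope_def_field, ← neg_sub z (nodes i), div_neg]
  ring

lemma abs_berrut_sub_le (hn : StrictAnti nodes) (hmem : ∀ i ∈ s, nodes i ∈ Icc a b)
    (hg : ∀ t ∈ Icc a b, HasDerivAt g (g' t) t) (hB : ∀ t ∈ Icc a b, |g' t| ≤ B)
    (hlip : LipschitzOnWith L g' (Icc a b)) (hz : z ∈ Icc a b) {δ : ℝ} (hδ : 0 < δ)
    (hden : (∀ i ∈ s, nodes i ≠ z) → δ ≤ |berrutDen s nodes z|) :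
    |berrut s nodes (fun i => g (nodes i)) z - g z| ≤ (2 * B + L * (b - a)) / δ := by
  have hB0 : 0 ≤ B := (abs_nonneg _).trans (hB z hz)
  have hab : a ≤ b := hz.1.trans hz.2
  by_cases hnode : ∀ i ∈ s, nodes i ≠ z
  · have hδden := hden hnode
    rw [berrut_sub_eq hnode (abs_pos.1 (hδ.trans_le hδden)), abs_div, abs_neg]
    gcongr
    exact abs_altSum_le hn hab hB0 hmem
      (fun i hi => abs_slope_le (convex_Icc a b) hg hB hz (hmem i hi) (hnode i hi))
      fun i hi j hj => abs_slope_sub_slope_le (convex_Icc a b) hg hlip hz (hmem i hi) (hmem j hj)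
        (hnode i hi) (hnode j hj)
  · push Not at hnode
    obtain ⟨i, hi, rfl⟩ := hnode
    rw [berrut_node hn _ hi, sub_self, abs_zero]
    have := mul_nonneg L.coe_nonneg (sub_nonneg.2 hab)
    positivity

end BerrutError

section BerrutRegularity

variable {n : ℕ} {nodes : Fin n → ℝ}

/-- The polynomial `∑ᵢ (-1)ⁱ yᵢ ∏_{j ≠ i} (z - tⱼ)`. Berrut's interpolant of the data `(tᵢ, yᵢ)` is
the quotient of this polynomial by the one with all `yᵢ = 1`, which shows that it is smooth. -/
noncomputable def berrutPoly (nodes y : Fin n → ℝ) (z : ℝ) : ℝ :=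
  ∑ i, berrutSign Finset.univ i * y i * ∏ j ∈ Finset.univ.erase i, (z - nodes j)

lemma contDiff_berrutPoly (nodes y : Fin n → ℝ) {r : WithTop ℕ∞} :
    ContDiff ℝ r (berrutPoly nodes y) := by
  unfold berrutPoly
  fun_prop

lemma berrutPoly_node (nodes y : Fin n → ℝ) (i : Fin n) :
    berrutPoly nodes y (nodes i) =
      berrutSign Finset.univ i * y i * ∏ j ∈ Finset.univ.erase i, (nodes i - nodes j) := by
  rw [berrutPoly, Finset.sum_eq_single_of_mem i (Finset.mem_univ i)]
  intro k _ hki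
  rw [Finset.prod_eq_zero (i := i) (by simp [hki.symm]) (sub_self _), mul_zero]

lemma berrutPoly_of_ne (y : Fin n → ℝ) {z : ℝ} (hz : ∀ i, nodes i ≠ z) :
    berrutPoly nodes y z =
      (∏ j, (z - nodes j)) * altSum Finset.univ fun i => y i / (z - nodes i) := by
  rw [berrutPoly, altSum, Finset.mul_sum]
  refine Finset.sum_congr rfl fun i _ => ?_
  rw [← Finset.mul_prod_erase Finset.univ _ (Finset.mem_univ i)]
  have := sub_ne_zero.2 (hz i).symm
  field_simp

lemma exists_pos_forall_le_sub (hn : StrictAnti nodes) :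
    ∃ d > 0, ∀ i j, i < j → d ≤ nodes i - nodes j := by
  have hsmall : ∀ᶠ d in 𝓝[>] (0 : ℝ), ∀ i j, i < j → d ≤ nodes i - nodes j := by
    simp only [eventually_all]
    exact fun i j hij =>
      (eventually_le_nhds (sub_pos.2 (hn hij))).filter_mono nhdsWithin_le_nhds
  obtain ⟨d, hd, hd0⟩ := (hsmall.and self_mem_nhdsWithin).exists
  exact ⟨d, hd0, hd⟩

lemma berrutPoly_one_ne_zero (hn0 : 0 < n) (hn : StrictAnti nodes) (z : ℝ) :
    berrutPoly nodes (fun _ => 1) z ≠ 0 := by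
  by_cases hz : ∀ i, nodes i ≠ z
  · rw [berrutPoly_of_ne _ hz]
    refine mul_ne_zero (Finset.prod_ne_zero_iff.2 fun j _ => sub_ne_zero.2 (hz j).symm) ?_
    obtain ⟨d, hd, hsep⟩ := exists_pos_forall_le_sub hn
    have hdist : 0 < |z - nodes ⟨0, hn0⟩| := abs_pos.2 (sub_ne_zero.2 (hz _).symm)
    have hden := div_le_abs_berrutDen hn (fun i _ => hz i) (Finset.mem_univ ⟨0, hn0⟩) le_rfl hd.le
      fun i _ j _ => hsep i j
    exact abs_pos.1 (lt_of_lt_of_le (by positivity) hden)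
  · push Not at hz
    obtain ⟨i, rfl⟩ := hz
    rw [berrutPoly_node]
    refine mul_ne_zero (by simp [berrutSign]) (Finset.prod_ne_zero_iff.2 fun j hj => ?_)
    exact sub_ne_zero.2 (hn.injective.ne (Finset.ne_of_mem_erase hj).symm)

lemma berrut_univ_eq (hn0 : 0 < n) (hn : StrictAnti nodes) (y : Fin n → ℝ) (z : ℝ) :
    berrut Finset.univ nodes y z = berrutPoly nodes y z / berrutPoly nodes (fun _ => 1) z := by
  by_cases hz : ∀ i, nodes i ≠ z
  · rw [berrut_of_ne fun i _ => hz i, berrutPoly_of_ne y hz, berrutPoly_of_ne _ hz,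
      mul_div_mul_left _ _ (Finset.prod_ne_zero_iff.2 fun j _ => sub_ne_zero.2 (hz j).symm),
      berrutDen]
  · push Not at hz
    obtain ⟨i, rfl⟩ := hz
    rw [berrut_node hn y (Finset.mem_univ i), eq_div_iff (berrutPoly_one_ne_zero hn0 hn _),
      berrutPoly_node, berrutPoly_node]
    ring

lemma contDiff_berrut_univ (hn0 : 0 < n) (hn : StrictAnti nodes) (y : Fin n → ℝ)
    {r : WithTop ℕ∞} : ContDiff ℝ r (berrut Finset.univ nodes y) := by
  rw [funext (berrut_univ_eq hn0 hn y)]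
  exact (contDiff_berrutPoly _ _).div (contDiff_berrutPoly _ _) (berrutPoly_one_ne_zero hn0 hn)

end BerrutRegularity

section BACC

variable {K N : ℕ}

lemma recoveryLoss_le_sq {f : ℝ → ℝ} {x : Fin K → ℝ} {u : ℝ → ℝ} {E : ℝ}
    (h : ∀ k, |u (encPoint K k) - f (x k)| ≤ E) : recoveryLoss f x u ≤ E ^ 2 := by
  calc recoveryLoss f x u ≤ 1 / (K : ℝ) * ∑ _k : Fin K, E ^ 2 := by
        rw [recoveryLoss]
        gcongr 1 / (K : ℝ) * ∑ k, ?_ with k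
        exact sq_le_sq' (abs_le.1 (h k)).1 (abs_le.1 (h k)).2
    _ = (K : ℝ)⁻¹ * K * E ^ 2 := by simp [mul_assoc]
    _ ≤ E ^ 2 := mul_le_of_le_one_left (sq_nonneg E) inv_mul_le_one

lemma div_le_abs_berrutDen_decPoint_of_noLongGap (hN : 2 ≤ N) {R : ℕ} (hR : 1 ≤ R)
    {F : Finset (Fin N)} (hF : NoLongGap R F) {θ₀ θ : ℝ} (hθ₀ : 0 ≤ θ₀)
    (hRθ₀ : ((R : ℝ) + 1) * decStep N ≤ θ₀ / 2) (hθ : θ ∈ Icc θ₀ (π - θ₀))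
    (hne : ∀ i ∈ F, decPoint N i ≠ cos θ) :
    sin (θ₀ / 2) / (π * R ^ 2 * decStep N) ≤ |berrutDen F (decPoint N) (cos θ)| := by
  obtain ⟨hθ1, hθ2⟩ := hθ
  have hstep := decStep_pos hN
  have hR' : (1 : ℝ) ≤ R := by exact_mod_cast hR
  have hπ := pi_gt_three
  have hsin0 : 0 ≤ sin (θ₀ / 2) := sin_nonneg_of_nonneg_of_le_pi (by linarith) (by linarith)
  obtain ⟨v, hv, hθv, hvθ⟩ := hF.exists_angle_mem_Ioc hN (hθ₀.trans hθ1) (by linarith)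
  have hnear : cos θ - decPoint N v ≤ R * decStep N := by
    rw [decPoint_eq_cos]
    refine (le_abs_self _).trans ((abs_cos_sub_cos_le _ _).trans ?_)
    rw [abs_of_neg (by linarith)]
    linarith
  have hsep : ∀ i ∈ F, i ≤ v → decPoint N i < cos θ → ∀ j ∈ F, i < j →
      2 * sin (θ₀ / 2) * (decStep N / π) ≤ decPoint N i - decPoint N j := by
    intro i _ hiv hiz j _ hij
    have hθi : θ ≤ i * decStep N := by
      by_contra! hlt
      rw [decPoint_eq_cos] at hiz
      exact hiz.not_ge (cos_le_cos_of_nonneg_of_le_pi (mul_decStep_mem_Icc hN i).1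
        (by linarith) hlt.le)
    have hiv' : (i : ℝ) * decStep N ≤ v * decStep N := by gcongr; exact_mod_cast hiv
    exact two_mul_sin_div_le_decPoint_sub hN hij (by linarith) (by linarith) (by linarith)
  have hgap : 2 * sin (θ₀ / 2) * (decStep N / π) ≤ R * decStep N := by
    calc 2 * sin (θ₀ / 2) * (decStep N / π) = 2 * sin (θ₀ / 2) / π * decStep N := by ring
      _ ≤ R * decStep N := by
        gcongr
        rw [div_le_iff₀ pi_pos]
        nlinarith [sin_le_one (θ₀ / 2)]
  calc sin (θ₀ / 2) / (π * R ^ 2 * decStep N)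
      = 2 * sin (θ₀ / 2) * (decStep N / π) / (R * decStep N * (R * decStep N + R * decStep N)) := by
        field_simp
        ring
    _ ≤ 2 * sin (θ₀ / 2) * (decStep N / π) /
          (R * decStep N * (R * decStep N + 2 * sin (θ₀ / 2) * (decStep N / π))) := by
        gcongr
    _ ≤ |berrutDen F (decPoint N) (cos θ)| :=
        div_le_abs_berrutDen_of_lt (decPoint_strictAnti hN) hne hv
          (by
            rw [decPoint_eq_cos]
            exact cos_lt_cos_of_nonneg_of_le_pi (hθ₀.trans hθ1) (mul_decStep_mem_Icc hN v).2 hθv)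
          hnear (by positivity) hsep

lemma one_div_le_abs_berrutDen_decPoint (hN : 2 ≤ N) {F : Finset (Fin N)} (hF : F.Nonempty)
    {z : ℝ} (hz : z ∈ Icc (-1 : ℝ) 1) (hne : ∀ i ∈ F, decPoint N i ≠ z) :
    1 / (4 * (N : ℝ) ^ 2) ≤ |berrutDen F (decPoint N) z| := by
  obtain ⟨v, hv⟩ := hF
  have hN1 := cast_sub_one_pos hN
  have hN1' : 1 ≤ (N : ℝ) - 1 := by
    have : (2 : ℝ) ≤ N := by exact_mod_cast hN
    linarith
  have hdist : |z - decPoint N v| ≤ 2 := by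
    rw [abs_le]
    constructor <;> linarith [hz.1, hz.2, (decPoint_mem_Icc v).1, (decPoint_mem_Icc v).2]
  have hd2 : 2 / ((N : ℝ) - 1) ^ 2 ≤ 2 := div_le_self zero_le_two (one_le_pow₀ hN1')
  calc 1 / (4 * (N : ℝ) ^ 2) ≤ 1 / (4 * ((N : ℝ) - 1) ^ 2) := by
        gcongr
        linarith
    _ = 2 / ((N : ℝ) - 1) ^ 2 / (2 * (2 + 2)) := by
        field_simp
        norm_num
    _ ≤ 2 / ((N : ℝ) - 1) ^ 2 / (2 * (2 + 2 / ((N : ℝ) - 1) ^ 2)) := by gcongr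
    _ ≤ |berrutDen F (decPoint N) z| :=
        div_le_abs_berrutDen (decPoint_strictAnti hN) hne hv hdist (by positivity)
          fun i _ j _ hij => le_decPoint_sub hN hij

lemma baccEnc_encPoint (x : Fin K → ℝ) (k : Fin K) : baccEnc x (encPoint K k) = x k :=
  berrut_node (encPoint_strictAnti K) x (Finset.mem_univ k)

lemma exists_baccDec_error_le (hK : 0 < K) (x : Fin K → ℝ) {f : ℝ → ℝ} (hf : ContDiff ℝ 2 f) :
    ∃ E, 0 ≤ E ∧ ∀ N : ℕ, 2 ≤ N → ∀ (F : Finset (Fin N)) (k : Fin K) (δ : ℝ), 0 < δ →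
      ((∀ i ∈ F, decPoint N i ≠ encPoint K k) →
        δ ≤ |berrutDen F (decPoint N) (encPoint K k)|) →
      |baccDec f x F (encPoint K k) - f (x k)| ≤ E / δ := by
  have hg : ContDiff ℝ 2 (f ∘ baccEnc x) :=
    hf.comp (contDiff_berrut_univ hK (encPoint_strictAnti K) x)
  obtain ⟨B, L, hB, hL⟩ := exists_deriv_bounds hg (-1) 1
  have hB0 : 0 ≤ B := (abs_nonneg _).trans (hB 0 (by simp))
  refine ⟨2 * B + L * (1 - -1), by positivity, fun N hN F k δ hδ hden => ?_⟩
  have herror := abs_berrut_sub_le (decPoint_strictAnti hN) (fun i _ => decPoint_mem_Icc i)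
    (fun t _ => (hg.differentiable two_ne_zero).differentiableAt.hasDerivAt) hB hL
    (encPoint_mem_Icc k) hδ hden
  simpa only [Function.comp_apply, baccEnc_encPoint, baccDec] using herror

variable {p : ℝ}

lemma exists_recoveryLoss_baccDec_le_of_noLongGap (hp0 : 0 < p) (hp1 : p < 1) (hK : 0 < K)
    (x : Fin K → ℝ) {f : ℝ → ℝ} (hf : ContDiff ℝ 2 f) :
    ∃ C, 0 ≤ C ∧ ∀ᶠ N : ℕ in atTop, ∀ F : Finset (Fin N), NoLongGap (windowLength p N) F →
      recoveryLoss f x (baccDec f x F) ≤ C * baccRate p N := by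
  obtain ⟨E, hE, herror⟩ := exists_baccDec_error_le hK x hf
  have hK' : (1 : ℝ) ≤ K := by exact_mod_cast hK
  have hθ₀ : 0 < π / (2 * K) := by positivity
  have hsin : 0 < sin (π / (2 * K) / 2) := by
    refine sin_pos_of_pos_of_lt_pi (by positivity) ?_
    rw [div_div, div_lt_iff₀ (by positivity)]
    nlinarith [pi_pos]
  refine ⟨(144 * π ^ 2 * E / sin (π / (2 * K) / 2)) ^ 2, by positivity, ?_⟩
  filter_upwards [eventually_ge_atTop 2, eventually_one_le_logb hp0 hp1,
    (tendsto_windowLength_add_one_mul_decStep hp0 hp1).eventually_le_const (half_pos hθ₀)]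
    with N hN hlog hwindow F hF
  have hR := one_le_windowLength hlog
  have : (0 : ℝ) < windowLength p N := by exact_mod_cast hR
  have hstep := decStep_pos hN
  have hscale : (windowLength p N : ℝ) ^ 2 * decStep N ≤
      8 * logb (1 / p) N * (18 * π * (logb (1 / p) N / N)) := by
    calc (windowLength p N : ℝ) ^ 2 * decStep N
        ≤ windowLength p N * ((windowLength p N + 1) * decStep N) := by nlinarith
      _ ≤ 8 * logb (1 / p) N * (18 * π * (logb (1 / p) N / N)) :=
        mul_le_mul (windowLength_le hlog) (windowLength_add_one_mul_decStep_le hN hlog)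
          (by positivity) (by linarith)
  have hpoint : ∀ k, |baccDec f x F (encPoint K k) - f (x k)| ≤
      144 * π ^ 2 * E / sin (π / (2 * K) / 2) * (logb (1 / p) N ^ 2 / N) := fun k =>
    calc |baccDec f x F (encPoint K k) - f (x k)|
        ≤ E / (sin (π / (2 * K) / 2) / (π * windowLength p N ^ 2 * decStep N)) :=
          herror N hN F k _ (by positivity) <|
            div_le_abs_berrutDen_decPoint_of_noLongGap hN hR hF hθ₀.le hwindow (encAngle_mem_Icc k)
      _ = E * π / sin (π / (2 * K) / 2) * (windowLength p N ^ 2 * decStep N) := by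
          field_simp
      _ ≤ E * π / sin (π / (2 * K) / 2) *
            (8 * logb (1 / p) N * (18 * π * (logb (1 / p) N / N))) := by gcongr
      _ = 144 * π ^ 2 * E / sin (π / (2 * K) / 2) * (logb (1 / p) N ^ 2 / N) := by ring
  calc recoveryLoss f x (baccDec f x F)
      ≤ (144 * π ^ 2 * E / sin (π / (2 * K) / 2) * (logb (1 / p) N ^ 2 / N)) ^ 2 :=
        recoveryLoss_le_sq hpoint
    _ = (144 * π ^ 2 * E / sin (π / (2 * K) / 2)) ^ 2 * baccRate p N := by
        rw [baccRate]
        ring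

lemma exists_recoveryLoss_baccDec_le (hK : 0 < K) (x : Fin K → ℝ) {f : ℝ → ℝ}
    (hf : ContDiff ℝ 2 f) :
    ∃ D, 0 ≤ D ∧ ∀ N : ℕ, 2 ≤ N → ∀ F : Finset (Fin N),
      recoveryLoss f x (baccDec f x F) ≤ D * (N : ℝ) ^ 4 := by
  obtain ⟨E, hE, herror⟩ := exists_baccDec_error_le hK x hf
  refine ⟨(4 * E + ∑ k, |f (x k)|) ^ 2, by positivity, fun N hN F => ?_⟩
  have hvalue : ∀ k, |f (x k)| ≤ ∑ k, |f (x k)| := fun k =>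
    Finset.single_le_sum (f := fun k => |f (x k)|) (fun k _ => abs_nonneg _) (Finset.mem_univ k)
  have hsum0 : 0 ≤ ∑ k, |f (x k)| := by positivity
  have hNsq : 1 ≤ (N : ℝ) ^ 2 := one_le_pow₀ (by exact_mod_cast (by omega : 1 ≤ N))
  have hpoint : ∀ k, |baccDec f x F (encPoint K k) - f (x k)| ≤
      (4 * E + ∑ k, |f (x k)|) * (N : ℝ) ^ 2 := by
    intro k
    rcases F.eq_empty_or_nonempty with rfl | hF
    · have hempty : baccDec f x (∅ : Finset (Fin N)) (encPoint K k) = 0 := by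
        simp [baccDec, berrut]
      rw [hempty, zero_sub, abs_neg]
      nlinarith [hvalue k]
    · calc |baccDec f x F (encPoint K k) - f (x k)| ≤ E / (1 / (4 * (N : ℝ) ^ 2)) :=
            herror N hN F k _ (by positivity) <|
              one_div_le_abs_berrutDen_decPoint hN hF (encPoint_mem_Icc k)
        _ = 4 * E * (N : ℝ) ^ 2 := by
            field_simp
        _ ≤ (4 * E + ∑ k, |f (x k)|) * (N : ℝ) ^ 2 := by
            gcongr
            linarith
  calc recoveryLoss f x (baccDec f x F) ≤ ((4 * E + ∑ k, |f (x k)|) * (N : ℝ) ^ 2) ^ 2 :=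
        recoveryLoss_le_sq hpoint
    _ = (4 * E + ∑ k, |f (x k)|) ^ 2 * (N : ℝ) ^ 4 := by ring

lemma baccRate_nonneg (p : ℝ) (N : ℕ) : 0 ≤ baccRate p N := by
  rw [baccRate]
  positivity

theorem bacc_expect_le (hp0 : 0 < p) (hp1 : p < 1) (hK : 0 < K) (x : Fin K → ℝ) {f : ℝ → ℝ}
    (hf : ContDiff ℝ 2 f) :
    ∃ (C : ℝ) (n₀ : ℕ), ∀ N : ℕ, n₀ ≤ N →
      expect p (fun F : Finset (Fin N) => recoveryLoss f x (baccDec f x F)) ≤ C * baccRate p N := by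
  obtain ⟨C, hC, hgood⟩ := exists_recoveryLoss_baccDec_le_of_noLongGap hp0 hp1 hK x hf
  obtain ⟨D, hD, hall⟩ := exists_recoveryLoss_baccDec_le hK x hf
  refine ⟨C + D, eventually_atTop.1 ?_⟩
  filter_upwards [hgood, eventually_ge_atTop 2, eventually_one_le_logb hp0 hp1,
    eventually_expect_le hp0 hp1] with N hgood hN hlog hexpect
  have : (0 : ℝ) < N := by exact_mod_cast (by omega : 0 < N)
  have hCrate := mul_nonneg hC (baccRate_nonneg p N)
  calc expect p (fun F : Finset (Fin N) => recoveryLoss f x (baccDec f x F))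
      ≤ C * baccRate p N + D * (N : ℝ) ^ 4 * ((N : ℝ) ^ 6)⁻¹ :=
        hexpect _ _ _ (by positivity) hgood fun F => (hall N hN F).trans (by linarith)
    _ = C * baccRate p N + D * (1 / (N : ℝ) ^ 2) := by
        field_simp
    _ ≤ C * baccRate p N + D * baccRate p N := by
        rw [baccRate]
        gcongr
        exact one_le_pow₀ hlog
    _ = (C + D) * baccRate p N := by ring

theorem bacc_prob_ge (hp0 : 0 < p) (hp1 : p < 1) (hK : 0 < K) (x : Fin K → ℝ) {f : ℝ → ℝ}
    (hf : ContDiff ℝ 2 f) {δ : ℝ} (hδ : 0 < δ) :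
    ∃ (C : ℝ) (n₀ : ℕ), ∀ N : ℕ, n₀ ≤ N →
      1 - δ ≤ prob p (fun F : Finset (Fin N) =>
        recoveryLoss f x (baccDec f x F) ≤ C * baccRate p N) := by
  obtain ⟨C, -, hgood⟩ := exists_recoveryLoss_baccDec_le_of_noLongGap hp0 hp1 hK x hf
  refine ⟨C, eventually_atTop.1 ?_⟩
  filter_upwards [hgood, eventually_le_prob_le hp0 hp1 hδ] with N hgood hprob
  exact hprob _ _ hgood

end BACC

section WeakDerivative

variable {a b : ℝ} {u v w φ : ℝ → ℝ}

lemma integrableOn_Ioo_of_continuous (hφ : Continuous φ) : IntegrableOn φ (Ioo a b) :=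
  hφ.integrableOn_Icc.mono_set Ioo_subset_Icc_self

lemma integrableOn_Ioo_mul_of_continuous (hu : IntegrableOn u (Ioo a b)) (hφ : Continuous φ) :
    IntegrableOn (fun t => u t * φ t) (Ioo a b) :=
  hu.mul_continuousOn_of_subset hφ.continuousOn measurableSet_Ioo isCompact_Icc Ioo_subset_Icc_self

lemma setIntegral_Ioo_eq_intervalIntegral (hab : a ≤ b) (u : ℝ → ℝ) :
    ∫ t in Ioo a b, u t = ∫ t in a..b, u t := by
  rw [intervalIntegral.integral_of_le hab, integral_Ioc_eq_integral_Ioo]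

lemma hasWeakDeriv_of_absolutelyContinuousOnInterval
    (hu : AbsolutelyContinuousOnInterval u (-1) 1)
    (hv : ∀ᵐ t, t ∈ Ioo (-1 : ℝ) 1 → HasDerivAt u (v t) t) : HasWeakDeriv u v := by
  intro φ hφ _ hsupp
  have hφac : AbsolutelyContinuousOnInterval φ (-1) 1 :=
    (hφ.of_le (by exact_mod_cast le_top)).contDiffOn.absolutelyContinuousOnInterval
  have hend : ∀ t ∉ Ioo (-1 : ℝ) 1, φ t = 0 := fun t ht =>
    image_eq_zero_of_notMem_tsupport fun h => ht (hsupp h)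
  have hderiv : ∫ t in Ioo (-1 : ℝ) 1, deriv u t * φ t = ∫ t in Ioo (-1 : ℝ) 1, v t * φ t := by
    refine setIntegral_congr_ae measurableSet_Ioo ?_
    filter_upwards [hv] with t ht htm
    rw [(ht htm).deriv]
  have hparts := hu.integral_mul_deriv_eq_deriv_mul hφac
  rwa [hend 1 (by simp), hend (-1) (by simp), mul_zero, mul_zero, sub_zero, zero_sub,
    ← setIntegral_Ioo_eq_intervalIntegral (by norm_num),
    ← setIntegral_Ioo_eq_intervalIntegral (by norm_num), hderiv] at hparts

lemma exists_deriv_eq_of_integral_eq_zero {χ : ℝ → ℝ} (hχ : ContDiff ℝ ∞ χ)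
    (hs : tsupport χ ⊆ Ioo (-1) 1) (h0 : ∫ t in Ioo (-1 : ℝ) 1, χ t = 0) :
    ∃ ψ : ℝ → ℝ, ContDiff ℝ ∞ ψ ∧ HasCompactSupport ψ ∧ tsupport ψ ⊆ Ioo (-1) 1 ∧
      deriv ψ = χ := by
  obtain ⟨r, ⟨-, hr⟩, hsr⟩ := exists_pos_lt_subset_ball one_pos (isClosed_tsupport χ)
    (x := 0) (hs.trans (by simp [Real.ball_eq_Ioo]))
  have hInt : ∀ s t : ℝ, IntervalIntegrable χ volume s t := fun s t =>
    hχ.continuous.intervalIntegrable s t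
  have hzero : ∀ s t : ℝ, (∀ q ∈ uIcc s t, r ≤ |q|) → ∫ q in s..t, χ q = 0 := by
    refine fun s t hst => intervalIntegral.integral_zero_ae (Eventually.of_forall fun q hq => ?_)
    refine image_eq_zero_of_notMem_tsupport fun h => (hst q (uIoc_subset_uIcc hq)).not_gt ?_
    simpa using hsr h
  set ψ : ℝ → ℝ := fun t => ∫ s in (-1 : ℝ)..t, χ s
  have hψ : ∀ t, HasDerivAt ψ (χ t) t := fun t =>
    intervalIntegral.integral_hasDerivAt_right (hInt _ _)
      (hχ.continuous.stronglyMeasurableAtFilter _ _) hχ.continuous.continuousAt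
  have hderiv : deriv ψ = χ := funext fun t => (hψ t).deriv
  have hsub : tsupport ψ ⊆ Icc (-r) r := by
    refine closure_minimal (Function.support_subset_iff'.2 fun t ht => ?_) isClosed_Icc
    rcases le_or_gt (-r) t with hle | hlt
    · have hrt : r < t := lt_of_not_ge fun h => ht ⟨hle, h⟩
      have hright : ∫ s in t..1, χ s = 0 := hzero t 1 fun q hq =>
        ((le_min hrt.le hr.le).trans hq.1).trans (le_abs_self q)
      rwa [setIntegral_Ioo_eq_intervalIntegral (by norm_num),
        ← intervalIntegral.integral_add_adjacent_intervals (hInt (-1) t) (hInt t 1), hright,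
        add_zero] at h0
    · exact hzero (-1) t fun q hq =>
        le_abs.2 (Or.inr (le_neg.1 (hq.2.trans (max_le (by linarith) hlt.le))))
  refine ⟨ψ, ?_, .of_support_subset_isCompact isCompact_Icc ((subset_tsupport _).trans hsub),
    hsub.trans (Icc_subset_Ioo (by linarith) hr), hderiv⟩
  rw [contDiff_infty_iff_deriv, hderiv]
  exact ⟨fun t => (hψ t).differentiableAt, hχ⟩

lemma exists_contDiff_integral_eq_one : ∃ φ : ℝ → ℝ, ContDiff ℝ ∞ φ ∧
    tsupport φ ⊆ Ioo (-1) 1 ∧ ∫ t in Ioo (-1 : ℝ) 1, φ t = 1 := by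
  let β : ContDiffBump (0 : ℝ) := ⟨1 / 4, 1 / 2, by norm_num, by norm_num⟩
  have hsupp : tsupport (β.normed volume) ⊆ Ioo (-1 : ℝ) 1 := by
    rw [β.tsupport_normed_eq, Real.closedBall_eq_Icc]
    exact Icc_subset_Ioo (by norm_num [β]) (by norm_num [β])
  refine ⟨β.normed volume, β.contDiff_normed, hsupp, ?_⟩
  rw [setIntegral_eq_integral_of_forall_compl_eq_zero
    fun t ht => image_eq_zero_of_notMem_tsupport fun h => ht (hsupp h)]
  exact β.integral_normed

lemma HasWeakDeriv.integral_mul_eq_of_zero (h : HasWeakDeriv w 0)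
    (hw : IntegrableOn w (Ioo (-1) 1)) {φ₀ : ℝ → ℝ} (hφ₀ : ContDiff ℝ ∞ φ₀)
    (hφ₀s : tsupport φ₀ ⊆ Ioo (-1) 1) (hφ₀1 : ∫ t in Ioo (-1 : ℝ) 1, φ₀ t = 1)
    (hφ : ContDiff ℝ ∞ φ) (hφs : tsupport φ ⊆ Ioo (-1) 1) :
    ∫ t in Ioo (-1 : ℝ) 1, w t * φ t =
      (∫ t in Ioo (-1 : ℝ) 1, φ t) * ∫ t in Ioo (-1 : ℝ) 1, w t * φ₀ t := by
  set m := ∫ t in Ioo (-1 : ℝ) 1, φ t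
  have hmean : ∫ t in Ioo (-1 : ℝ) 1, (φ t - m * φ₀ t) = 0 := by
    rw [integral_sub (integrableOn_Ioo_of_continuous hφ.continuous)
      ((integrableOn_Ioo_of_continuous hφ₀.continuous).const_mul m), integral_const_mul, hφ₀1,
      mul_one, sub_self]
  have hsub : tsupport (fun t => φ t - m * φ₀ t) ⊆ Ioo (-1) 1 :=
    (tsupport_sub _ _).trans <| union_subset hφs <|
      (closure_mono (Function.support_mul_subset_right _ _)).trans hφ₀s
  obtain ⟨ψ, hψ, hψc, hψs, hψd⟩ := exists_deriv_eq_of_integral_eq_zero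
    (hφ.sub (contDiff_const.mul hφ₀)) hsub hmean
  have hweak := h ψ hψ hψc hψs
  simp only [hψd, Pi.zero_apply, zero_mul, integral_zero, neg_zero, mul_sub,
    mul_left_comm _ m] at hweak
  rwa [integral_sub (integrableOn_Ioo_mul_of_continuous hw hφ.continuous)
    ((integrableOn_Ioo_mul_of_continuous hw hφ₀.continuous).const_mul m), integral_const_mul,
    sub_eq_zero] at hweak

-- The du Bois-Reymond lemma.
lemma HasWeakDeriv.ae_eq_const (h : HasWeakDeriv w 0) (hw : IntegrableOn w (Ioo (-1) 1)) :
    ∃ c : ℝ, ∀ᵐ t, t ∈ Ioo (-1 : ℝ) 1 → w t = c := by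
  obtain ⟨φ₀, hφ₀, hφ₀s, hφ₀1⟩ := exists_contDiff_integral_eq_one
  set c := ∫ t in Ioo (-1 : ℝ) 1, w t * φ₀ t
  have hwc : IntegrableOn (fun t => w t - c) (Ioo (-1) 1) :=
    hw.sub (integrableOn_const (by simp))
  have hzero : ∀ᵐ t, t ∈ Ioo (-1 : ℝ) 1 → w t - c = 0 := by
    refine isOpen_Ioo.ae_eq_zero_of_integral_contDiff_smul_eq_zero hwc.locallyIntegrableOn
      fun φ hφ _ hφs => ?_
    have hcompl : ∀ t, t ∉ Ioo (-1 : ℝ) 1 → φ t • (w t - c) = 0 := fun t ht => by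
      rw [image_eq_zero_of_notMem_tsupport fun h' => ht (hφs h'), zero_smul]
    rw [← setIntegral_eq_integral_of_forall_compl_eq_zero hcompl]
    simp only [smul_eq_mul, mul_comm (φ _), sub_mul]
    rw [integral_sub (integrableOn_Ioo_mul_of_continuous hw hφ.continuous)
      ((integrableOn_Ioo_of_continuous hφ.continuous).const_mul c), integral_const_mul,
      h.integral_mul_eq_of_zero hw hφ₀ hφ₀s hφ₀1 hφ hφs, mul_comm, sub_self]
  refine ⟨c, ?_⟩
  filter_upwards [hzero] with t ht htm
  exact sub_eq_zero.1 (ht htm)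

lemma HasWeakDeriv.sub {u₁ u₂ v₁ v₂ : ℝ → ℝ} (h₁ : HasWeakDeriv u₁ v₁) (h₂ : HasWeakDeriv u₂ v₂)
    (hu₁ : IntegrableOn u₁ (Ioo (-1) 1)) (hu₂ : IntegrableOn u₂ (Ioo (-1) 1))
    (hv₁ : IntegrableOn v₁ (Ioo (-1) 1)) (hv₂ : IntegrableOn v₂ (Ioo (-1) 1)) :
    HasWeakDeriv (u₁ - u₂) (v₁ - v₂) := by
  intro φ hφ hc hs
  have hφ' : Continuous (deriv φ) := hφ.continuous_deriv (by exact_mod_cast le_top)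
  simp only [Pi.sub_apply, sub_mul]
  rw [integral_sub (integrableOn_Ioo_mul_of_continuous hu₁ hφ')
      (integrableOn_Ioo_mul_of_continuous hu₂ hφ'),
    integral_sub (integrableOn_Ioo_mul_of_continuous hv₁ hφ.continuous)
      (integrableOn_Ioo_mul_of_continuous hv₂ hφ.continuous), h₁ φ hφ hc hs, h₂ φ hφ hc hs]
  ring

/-- The primitive, vanishing at `-1`, of the restriction of `v` to `(-1, 1)`. Cutting `v` off makes
it continuous on the whole line, so that no end point of the interval needs special treatment. -/
noncomputable def primitive (v : ℝ → ℝ) (t : ℝ) : ℝ :=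
  ∫ s in (-1 : ℝ)..t, (Ioo (-1 : ℝ) 1).indicator v s

lemma intervalIntegrable_indicator_Ioo (hv : IntegrableOn v (Ioo a b)) (s t : ℝ) :
    IntervalIntegrable ((Ioo a b).indicator v) volume s t :=
  (hv.integrable_indicator measurableSet_Ioo).intervalIntegrable

lemma continuous_primitive (hv : IntegrableOn v (Ioo (-1) 1)) : Continuous (primitive v) :=
  intervalIntegral.continuous_primitive (intervalIntegrable_indicator_Ioo hv) _

lemma absolutelyContinuousOnInterval_primitive (hv : IntegrableOn v (Ioo (-1) 1)) :
    AbsolutelyContinuousOnInterval (primitive v) (-1) 1 :=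
  (intervalIntegrable_indicator_Ioo hv _ _).absolutelyContinuousOnInterval_intervalIntegral
    left_mem_uIcc

lemma ae_hasDerivAt_primitive (hv : IntegrableOn v (Ioo (-1) 1)) :
    ∀ᵐ t, t ∈ Ioo (-1 : ℝ) 1 → HasDerivAt (primitive v) (v t) t := by
  filter_upwards [LocallyIntegrable.ae_hasDerivAt_integral
    (hv.integrable_indicator measurableSet_Ioo).locallyIntegrable] with t ht htm
  have := ht (-1)
  rwa [indicator_of_mem htm] at this

lemma primitive_sub_primitive (hv : IntegrableOn v (Ioo (-1) 1)) (s t : ℝ) :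
    primitive v t - primitive v s = ∫ r in s..t, (Ioo (-1 : ℝ) 1).indicator v r :=
  intervalIntegral.integral_interval_sub_left (intervalIntegrable_indicator_Ioo hv _ _)
    (intervalIntegrable_indicator_Ioo hv _ _)

lemma HasWeakDeriv.ae_eq_add_primitive (h : HasWeakDeriv u v) (hu : IntegrableOn u (Ioo (-1) 1))
    (hv : IntegrableOn v (Ioo (-1) 1)) :
    ∃ c : ℝ, ∀ᵐ t, t ∈ Ioo (-1 : ℝ) 1 → u t = c + primitive v t := by
  have hprim : IntegrableOn (primitive v) (Ioo (-1) 1) :=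
    integrableOn_Ioo_of_continuous (continuous_primitive hv)
  have hdiff : HasWeakDeriv (u - primitive v) 0 := by
    simpa using h.sub (hasWeakDeriv_of_absolutelyContinuousOnInterval
      (absolutelyContinuousOnInterval_primitive hv) (ae_hasDerivAt_primitive hv)) hu hprim hv hv
  obtain ⟨c, hc⟩ := hdiff.ae_eq_const (hu.sub hprim)
  refine ⟨c, ?_⟩
  filter_upwards [hc] with t ht htm
  exact sub_eq_iff_eq_add.1 (ht htm)

end WeakDerivative

section RealAnalysis

variable {a b c d s t H C : ℝ} {e e' w : ℝ → ℝ}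

lemma memLp_Ioo_of_continuousOn (hw : ContinuousOn w (Icc a b)) (q : ENNReal) :
    MemLp w q (volume.restrict (Ioo a b)) := by
  obtain ⟨C, hC⟩ := isCompact_Icc.exists_bound_of_continuousOn hw
  refine MemLp.of_bound
    ((hw.mono Ioo_subset_Icc_self).aestronglyMeasurable measurableSet_Ioo) C ?_
  filter_upwards [ae_restrict_mem measurableSet_Ioo] with t ht
  exact hC t (Ioo_subset_Icc_self ht)

lemma absolutelyContinuousOnInterval_of_abs_deriv_le (hab : a ≤ b)
    (he : ∀ t ∈ Icc a b, HasDerivAt e (e' t) t) (hC : ∀ t ∈ Icc a b, |e' t| ≤ C) :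
    AbsolutelyContinuousOnInterval e a b := by
  refine LipschitzOnWith.absolutelyContinuousOnInterval (K := C.toNNReal) ?_
  rw [uIcc_of_le hab]
  refine (convex_Icc a b).lipschitzOnWith_of_nnnorm_hasDerivWithin_le
    (fun t ht => (he t ht).hasDerivWithinAt) fun t ht => ?_
  rw [← NNReal.coe_le_coe, coe_nnnorm]
  exact (hC t ht).trans (Real.le_coe_toNNReal C)

lemma sq_intervalIntegral_le (hst : s ≤ t) (hw : IntervalIntegrable w volume s t)
    (hw2 : IntervalIntegrable (fun r => w r ^ 2) volume s t) :
    (∫ r in s..t, w r) ^ 2 ≤ (t - s) * ∫ r in s..t, w r ^ 2 := by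
  rcases hst.eq_or_lt with rfl | hlt
  · simp
  have hts : 0 < t - s := sub_pos.2 hlt
  set I := ∫ r in s..t, w r
  have hvar : ∫ r in s..t, ((t - s) * w r - I) ^ 2 =
      (t - s) * ((t - s) * (∫ r in s..t, w r ^ 2) - I ^ 2) := by
    have hexpand : ∀ r, ((t - s) * w r - I) ^ 2 =
        (t - s) ^ 2 * w r ^ 2 - 2 * (t - s) * I * w r + I ^ 2 := fun r => by ring
    simp only [hexpand]
    rw [intervalIntegral.integral_add ((hw2.const_mul _).sub (hw.const_mul _))
        intervalIntegrable_const, intervalIntegral.integral_sub (hw2.const_mul _) (hw.const_mul _),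
      intervalIntegral.integral_const_mul, intervalIntegral.integral_const_mul,
      intervalIntegral.integral_const, smul_eq_mul]
    ring
  have hnonneg : 0 ≤ (t - s) * ((t - s) * (∫ r in s..t, w r ^ 2) - I ^ 2) :=
    hvar ▸ intervalIntegral.integral_nonneg hst fun r _ => sq_nonneg _
  linarith [(mul_nonneg_iff_of_pos_left hts).1 hnonneg]

lemma abs_deriv_le_slope_add (he : ∀ t ∈ Icc c d, HasDerivAt e (e' t) t)
    (hH : ∀ s ∈ Icc c d, ∀ t ∈ Icc c d, |e' t - e' s| ≤ H) (ha : a ∈ Icc c d)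
    (hb : b ∈ Icc c d) (hab : a ≠ b) (ht : t ∈ Icc c d) :
    |e' t| ≤ |e b - e a| / |b - a| + H := by
  wlog hlt : a < b generalizing a b
  · rw [abs_sub_comm (e b), abs_sub_comm b]
    exact this hb ha hab.symm (hab.lt_or_gt.resolve_left hlt)
  have hsub : Icc a b ⊆ Icc c d := Icc_subset_Icc ha.1 hb.2
  obtain ⟨ξ, hξ, hslope⟩ := exists_hasDerivAt_eq_slope e e' hlt
    (fun t ht => (he t (hsub ht)).continuousAt.continuousWithinAt)
    fun t ht => he t (hsub (Ioo_subset_Icc_self ht))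
  rw [← abs_div, ← hslope]
  linarith [hH ξ (hsub (Ioo_subset_Icc_self hξ)) t ht, abs_sub_abs_le_abs_sub (e' t) (e' ξ)]

lemma abs_le_of_abs_deriv_sub_le (he : ∀ t ∈ Icc c d, HasDerivAt e (e' t) t)
    (hH : ∀ s ∈ Icc c d, ∀ t ∈ Icc c d, |e' t - e' s| ≤ H) (ha : a ∈ Icc c d)
    (hb : b ∈ Icc c d) (hab : a ≠ b) (ht : t ∈ Icc c d) :
    |e t| ≤ |e a| + (|e b - e a| / |b - a| + H) * |t - a| := by
  have hmvt : |e t - e a| ≤ (|e b - e a| / |b - a| + H) * |t - a| :=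
    (convex_Icc c d).norm_image_sub_le_of_norm_hasDerivWithin_le
      (fun r hr => (he r hr).hasDerivWithinAt)
      (fun r hr => abs_deriv_le_slope_add he hH ha hb hab hr) ha ht
  linarith [abs_sub_abs_le_abs_sub (e t) (e a)]

end RealAnalysis

namespace SobolevH2

section ContinuousRepresentative

variable (u : SobolevH2)

lemma integrableOn_toFun : IntegrableOn u.toFun (Ioo (-1) 1) :=
  u.continuousOn_toFun.integrableOn_Icc.mono_set Ioo_subset_Icc_self

lemma integrableOn_d1 : IntegrableOn u.d1 (Ioo (-1) 1) :=
  u.memLp_d1.integrable one_le_two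

lemma integrableOn_d2 : IntegrableOn u.d2 (Ioo (-1) 1) :=
  u.memLp_d2.integrable one_le_two

lemma roughness_nonneg : 0 ≤ u.roughness :=
  integral_nonneg fun _ => sq_nonneg _

lemma exists_d1_ae_eq : ∃ c : ℝ, ∀ᵐ t, t ∈ Ioo (-1 : ℝ) 1 → u.d1 t = c + primitive u.d2 t :=
  u.hasWeakDeriv_d2.ae_eq_add_primitive u.integrableOn_d1 u.integrableOn_d2

lemma exists_toFun_ae_eq :
    ∃ c : ℝ, ∀ᵐ t, t ∈ Ioo (-1 : ℝ) 1 → u.toFun t = c + primitive u.d1 t :=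
  u.hasWeakDeriv_d1.ae_eq_add_primitive u.integrableOn_toFun u.integrableOn_d1

/-- The absolutely continuous representative of the weak derivative of `u`, on the whole line. -/
noncomputable def der (t : ℝ) : ℝ := u.exists_d1_ae_eq.choose + primitive u.d2 t

/-- The continuously differentiable function with derivative `u.der` that agrees with `u` on
`[-1, 1]`; the values of `u.toFun` elsewhere are arbitrary. -/
noncomputable def ext (t : ℝ) : ℝ := u.exists_toFun_ae_eq.choose + ∫ s in (-1 : ℝ)..t, u.der s

lemma continuous_der : Continuous u.der :=
  continuous_const.add (continuous_primitive u.integrableOn_d2)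

lemma absolutelyContinuousOnInterval_der : AbsolutelyContinuousOnInterval u.der (-1) 1 :=
  AbsolutelyContinuousOnInterval.add
    (LipschitzWith.const _).lipschitzOnWith.absolutelyContinuousOnInterval
    (absolutelyContinuousOnInterval_primitive u.integrableOn_d2)

lemma exists_abs_der_le : ∃ B : ℝ, ∀ t ∈ Icc (-1 : ℝ) 1, |u.der t| ≤ B :=
  isCompact_Icc.exists_bound_of_continuousOn u.continuous_der.continuousOn

lemma ae_hasDerivAt_der : ∀ᵐ t, t ∈ Ioo (-1 : ℝ) 1 → HasDerivAt u.der (u.d2 t) t := by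
  filter_upwards [ae_hasDerivAt_primitive u.integrableOn_d2] with t ht htm
  exact (ht htm).const_add _

lemma hasDerivAt_ext (t : ℝ) : HasDerivAt u.ext (u.der t) t :=
  (intervalIntegral.integral_hasDerivAt_right (u.continuous_der.intervalIntegrable _ _)
    (u.continuous_der.stronglyMeasurableAtFilter _ _) u.continuous_der.continuousAt).const_add _

lemma continuous_ext : Continuous u.ext :=
  continuous_iff_continuousAt.2 fun t => (u.hasDerivAt_ext t).continuousAt

lemma eqOn_ext : EqOn u.toFun u.ext (Icc (-1) 1) := by
  refine Measure.eqOn_Icc_of_ae_eq volume (by norm_num) ?_ u.continuousOn_toFun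
    u.continuous_ext.continuousOn
  rw [← restrict_Ioo_eq_restrict_Icc]
  refine (ae_restrict_iff' measurableSet_Ioo).2 ?_
  filter_upwards [u.exists_toFun_ae_eq.choose_spec] with t ht htm
  rw [ht htm, ext, primitive]
  congr 1
  refine intervalIntegral.integral_congr_ae ?_
  filter_upwards [u.exists_d1_ae_eq.choose_spec] with s hs hst
  rw [uIoc_of_le htm.1.le] at hst
  have hsm : s ∈ Ioo (-1 : ℝ) 1 := ⟨hst.1, hst.2.trans_lt htm.2⟩
  rw [indicator_of_mem hsm, hs hsm, der]

lemma sq_der_sub_le {s t : ℝ} (hst : s ≤ t) :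
    (u.der t - u.der s) ^ 2 ≤ (t - s) * u.roughness := by
  set w := (Ioo (-1 : ℝ) 1).indicator u.d2
  have hsq : (fun r => w r ^ 2) = (Ioo (-1 : ℝ) 1).indicator fun r => u.d2 r ^ 2 := by
    ext r
    by_cases h : r ∈ Ioo (-1 : ℝ) 1 <;> simp [w, h]
  have hInt : Integrable fun r => w r ^ 2 := by
    rw [hsq]
    exact IntegrableOn.integrable_indicator u.memLp_d2.integrable_sq measurableSet_Ioo
  have hrough : ∫ r in s..t, w r ^ 2 ≤ u.roughness := by
    rw [roughness, ← integral_indicator measurableSet_Ioo, ← hsq,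
      intervalIntegral.integral_of_le hst]
    exact setIntegral_le_integral hInt (Eventually.of_forall fun r => sq_nonneg _)
  have hder : u.der t - u.der s = ∫ r in s..t, w r := by
    rw [der, der, add_sub_add_left_eq_sub, primitive_sub_primitive u.integrableOn_d2]
  rw [hder]
  exact (sq_intervalIntegral_le hst (intervalIntegrable_indicator_Ioo u.integrableOn_d2 s t)
    hInt.intervalIntegrable).trans (mul_le_mul_of_nonneg_left hrough (sub_nonneg.2 hst))

variable {u} {g : SobolevH2} {a b c d r s t z G : ℝ}

lemma abs_der_sub_le (hu : u.roughness ≤ G) (hs : s ∈ Icc c d) (ht : t ∈ Icc c d) :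
    |u.der t - u.der s| ≤ √G * √(d - c) := by
  wlog hst : s ≤ t generalizing s t
  · rw [abs_sub_comm]
    exact this ht hs (le_of_not_ge hst)
  rw [← sqrt_mul (u.roughness_nonneg.trans hu), mul_comm]
  refine abs_le_sqrt ((u.sq_der_sub_le hst).trans ?_)
  have := u.roughness_nonneg
  gcongr
  exacts [sub_nonneg.2 (hs.1.trans hs.2), ht.2, hs.1]

theorem abs_sub_le (hu : u.roughness ≤ G) (hg : g.roughness ≤ G)
    (hcd : Icc c d ⊆ Icc (-1 : ℝ) 1) (ha : a ∈ Icc c d) (hb : b ∈ Icc c d) (hab : a ≠ b)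
    (hra : |u.toFun a - g.toFun a| ≤ r) (hrb : |u.toFun b - g.toFun b| ≤ r) (hz : z ∈ Icc c d) :
    |u.toFun z - g.toFun z| ≤ r + (2 * r / |b - a| + 2 * √G * √(d - c)) * |z - a| := by
  rw [u.eqOn_ext (hcd ha), g.eqOn_ext (hcd ha)] at hra
  rw [u.eqOn_ext (hcd hb), g.eqOn_ext (hcd hb)] at hrb
  rw [u.eqOn_ext (hcd hz), g.eqOn_ext (hcd hz)]
  have hosc : ∀ s ∈ Icc c d, ∀ t ∈ Icc c d,
      |(u.der t - g.der t) - (u.der s - g.der s)| ≤ 2 * √G * √(d - c) := fun s hs t ht => by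
    rw [sub_sub_sub_comm]
    linarith [abs_sub (u.der t - u.der s) (g.der t - g.der s), abs_der_sub_le hu hs ht,
      abs_der_sub_le hg hs ht]
  have hslope : |u.ext b - g.ext b - (u.ext a - g.ext a)| ≤ 2 * r := by
    linarith [abs_sub (u.ext b - g.ext b) (u.ext a - g.ext a)]
  refine (abs_le_of_abs_deriv_sub_le (e := fun t => u.ext t - g.ext t)
    (fun t _ => (u.hasDerivAt_ext t).sub (g.hasDerivAt_ext t)) hosc ha hb hab hz).trans ?_
  gcongr

end ContinuousRepresentative

/-- A differentiable function whose derivative `w'` is absolutely continuous with square integrable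
derivative `w''`, as an element of `H²`. -/
noncomputable def ofHasDerivAt (w w' w'' : ℝ → ℝ) (hw : ∀ t, HasDerivAt w (w' t) t)
    (hac : AbsolutelyContinuousOnInterval w' (-1) 1)
    (hw' : ∀ᵐ t, t ∈ Ioo (-1 : ℝ) 1 → HasDerivAt w' (w'' t) t)
    (hmem : MemLp w'' 2 (volume.restrict (Ioo (-1) 1))) : SobolevH2 :=
  have hcont : ContinuousOn w' (Icc (-1) 1) := by
    simpa only [uIcc_of_le (by norm_num : (-1 : ℝ) ≤ 1)] using hac.continuousOn
  { toFun := w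
    d1 := w'
    d2 := w''
    continuousOn_toFun := fun t _ => (hw t).continuousAt.continuousWithinAt
    memLp_d1 := memLp_Ioo_of_continuousOn hcont 2
    memLp_d2 := hmem
    hasWeakDeriv_d1 := by
      obtain ⟨C, hC⟩ := isCompact_Icc.exists_bound_of_continuousOn hcont
      exact hasWeakDeriv_of_absolutelyContinuousOnInterval
        (absolutelyContinuousOnInterval_of_abs_deriv_le (by norm_num) (fun t _ => hw t) hC)
        (Eventually.of_forall fun t _ => hw t)
    hasWeakDeriv_d2 := hasWeakDeriv_of_absolutelyContinuousOnInterval hac hw' }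

/-- A twice continuously differentiable function as an element of `H²`. -/
noncomputable def ofContDiff (w : ℝ → ℝ) (hw : ContDiff ℝ 2 w) : SobolevH2 :=
  have hw' : ContDiff ℝ 1 (deriv w) :=
    (contDiff_succ_iff_deriv.1 (by simpa only [one_add_one_eq_two] using hw)).2.2
  ofHasDerivAt w (deriv w) (deriv (deriv w))
    (fun t => (hw.differentiable two_ne_zero t).hasDerivAt)
    hw'.contDiffOn.absolutelyContinuousOnInterval
    (Eventually.of_forall fun t _ => (hw'.differentiable one_ne_zero t).hasDerivAt)
    (memLp_Ioo_of_continuousOn (hw'.continuous_deriv le_rfl).continuousOn 2)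

section Comp

variable (u : SobolevH2) {f : ℝ → ℝ} {η : ℝ}

lemma absolutelyContinuousOnInterval_comp_ext {g : ℝ → ℝ} (hg : Differentiable ℝ g)
    (hη : ∀ t, |deriv g t| ≤ η) :
    AbsolutelyContinuousOnInterval (fun t => g (u.ext t)) (-1) 1 := by
  obtain ⟨B, hB⟩ := u.exists_abs_der_le
  refine absolutelyContinuousOnInterval_of_abs_deriv_le (C := η * B) (by norm_num)
    (fun t _ => (hg _).hasDerivAt.comp t (u.hasDerivAt_ext t)) fun t ht => ?_
  rw [abs_mul]
  exact mul_le_mul (hη _) (hB t ht) (abs_nonneg _) ((abs_nonneg _).trans (hη 0))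

lemma memLp_comp_ext_mul_der_mul_der {h : ℝ → ℝ} (hh : Measurable h) (hη : ∀ t, |h t| ≤ η) :
    MemLp (fun t => h (u.ext t) * u.der t * u.der t) 2 (volume.restrict (Ioo (-1) 1)) := by
  simp only [mul_assoc]
  have hder : Continuous fun t => u.der t * u.der t := u.continuous_der.mul u.continuous_der
  refine (memLp_Ioo_of_continuousOn hder.continuousOn 2).of_le_mul (c := η)
    ((hh.comp u.continuous_ext.measurable).mul hder.measurable).aestronglyMeasurable
    (Eventually.of_forall fun t => ?_)
  rw [norm_mul]
  exact mul_le_mul_of_nonneg_right (hη _) (norm_nonneg _)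

lemma memLp_comp_ext_mul_d2 {h : ℝ → ℝ} (hh : Continuous h) :
    MemLp (fun t => h (u.ext t) * u.d2 t) 2 (volume.restrict (Ioo (-1) 1)) := by
  have hcont : Continuous fun t => h (u.ext t) := hh.comp u.continuous_ext
  obtain ⟨C, hC⟩ := (isCompact_Icc (a := (-1 : ℝ)) (b := 1)).exists_bound_of_continuousOn
    hcont.continuousOn
  refine u.memLp_d2.of_le_mul (c := C)
    (hcont.aestronglyMeasurable.mul u.memLp_d2.aestronglyMeasurable) ?_
  filter_upwards [ae_restrict_mem measurableSet_Ioo] with t ht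
  rw [norm_mul]
  exact mul_le_mul_of_nonneg_right (hC t (Ioo_subset_Icc_self ht)) (norm_nonneg _)

/-- The composition `f ∘ u` as an element of `H²`, for `f` with bounded second derivative. -/
noncomputable def comp (hf : Differentiable ℝ f) (hf' : Differentiable ℝ (deriv f))
    (hη : ∀ t, |deriv (deriv f) t| ≤ η) : SobolevH2 :=
  ofHasDerivAt (fun t => f (u.ext t)) (fun t => deriv f (u.ext t) * u.der t)
    (fun t => deriv (deriv f) (u.ext t) * u.der t * u.der t + deriv f (u.ext t) * u.d2 t)
    (fun t => (hf _).hasDerivAt.comp t (u.hasDerivAt_ext t))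
    ((u.absolutelyContinuousOnInterval_comp_ext hf' hη).mul u.absolutelyContinuousOnInterval_der)
    (by
      filter_upwards [u.ae_hasDerivAt_der] with t ht htm
      exact ((hf' _).hasDerivAt.comp t (u.hasDerivAt_ext t)).mul (ht htm))
    ((u.memLp_comp_ext_mul_der_mul_der (measurable_deriv _) hη).add
      (u.memLp_comp_ext_mul_d2 hf'.continuous))

variable (hf : Differentiable ℝ f) (hf' : Differentiable ℝ (deriv f))
  (hη : ∀ t, |deriv (deriv f) t| ≤ η)

lemma eqOn_comp : EqOn (u.comp hf hf' hη).toFun (f ∘ u.toFun) (Icc (-1) 1) := fun t ht => by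
  rw [Function.comp_apply, u.eqOn_ext ht]
  rfl

lemma sq_comp_d2_le {B : ℝ} {ν t : ℝ} (hν : ∀ t, |deriv f t| ≤ ν) (hB : |u.der t| ≤ B) :
    (u.comp hf hf' hη).d2 t ^ 2 ≤ 2 * (η * B ^ 2) ^ 2 + 2 * ν ^ 2 * u.d2 t ^ 2 := by
  have hfirst : (deriv (deriv f) (u.ext t) * u.der t * u.der t) ^ 2 ≤ (η * B ^ 2) ^ 2 := by
    rw [mul_assoc, ← sq, ← sq_abs (_ * _), abs_mul, abs_sq, ← sq_abs (u.der t)]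
    gcongr
    exacts [(abs_nonneg _).trans (hη 0), hη _]
  have hsecond : (deriv f (u.ext t) * u.d2 t) ^ 2 ≤ ν ^ 2 * u.d2 t ^ 2 := by
    rw [mul_pow]
    exact mul_le_mul_of_nonneg_right (sq_le_sq' (abs_le.1 (hν _)).1 (abs_le.1 (hν _)).2)
      (sq_nonneg _)
  refine add_sq_le.trans ?_
  linarith

theorem roughness_comp_le {B ν : ℝ} (hν : ∀ t, |deriv f t| ≤ ν)
    (hB : ∀ t ∈ Icc (-1 : ℝ) 1, |u.der t| ≤ B) :
    (u.comp hf hf' hη).roughness ≤ 4 * (η * B ^ 2) ^ 2 + 2 * ν ^ 2 * u.roughness := by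
  have hInt : IntegrableOn (fun t => u.d2 t ^ 2) (Ioo (-1) 1) := u.memLp_d2.integrable_sq
  have hconst : IntegrableOn (fun _ : ℝ => 2 * (η * B ^ 2) ^ 2) (Ioo (-1) 1) :=
    integrableOn_const (by simp)
  calc (u.comp hf hf' hη).roughness
      ≤ ∫ t in Ioo (-1 : ℝ) 1, (2 * (η * B ^ 2) ^ 2 + 2 * ν ^ 2 * u.d2 t ^ 2) :=
        setIntegral_mono_on (u.comp hf hf' hη).memLp_d2.integrable_sq
          (hconst.add (hInt.const_mul _)) measurableSet_Ioo
          fun t ht => u.sq_comp_d2_le hf hf' hη hν (hB t (Ioo_subset_Icc_self ht))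
    _ = 4 * (η * B ^ 2) ^ 2 + 2 * ν ^ 2 * u.roughness := by
        rw [integral_add hconst (hInt.const_mul _), setIntegral_const, integral_const_mul,
          roughness, Real.volume_real_Ioo_of_le (by norm_num), smul_eq_mul]
        ring

end Comp

end SobolevH2

section SmoothingSplines

variable {n : ℕ} {s : Finset (Fin n)} {nodes y : Fin n → ℝ} {lam : ℝ} {u w : SobolevH2}

/-- The mean squared residual of `g` on the data `(nodes i, y i)`, `i ∈ s`: the part of
`splineObjective` that measures the fit. -/
noncomputable def meanSqResidual (s : Finset (Fin n)) (nodes y : Fin n → ℝ) (g : ℝ → ℝ) : ℝ :=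
  1 / (s.card : ℝ) * ∑ i ∈ s, (g (nodes i) - y i) ^ 2

lemma splineObjective_eq (s : Finset (Fin n)) (nodes y : Fin n → ℝ) (lam : ℝ) (u : SobolevH2) :
    splineObjective s nodes y lam u = meanSqResidual s nodes y u.toFun + lam * u.roughness :=
  rfl

lemma meanSqResidual_nonneg (s : Finset (Fin n)) (nodes y : Fin n → ℝ) (g : ℝ → ℝ) :
    0 ≤ meanSqResidual s nodes y g := by
  rw [meanSqResidual]
  positivity

lemma meanSqResidual_eq_zero {g : ℝ → ℝ} (hg : ∀ i ∈ s, g (nodes i) = y i) :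
    meanSqResidual s nodes y g = 0 := by
  rw [meanSqResidual,
    Finset.sum_eq_zero fun i hi => by rw [hg i hi, sub_self, zero_pow two_ne_zero], mul_zero]

lemma card_mul_meanSqResidual (s : Finset (Fin n)) (nodes y : Fin n → ℝ) (g : ℝ → ℝ) :
    s.card * meanSqResidual s nodes y g = ∑ i ∈ s, (g (nodes i) - y i) ^ 2 := by
  rcases s.eq_empty_or_nonempty with rfl | hs
  · simp
  · have : (s.card : ℝ) ≠ 0 := by exact_mod_cast hs.card_ne_zero
    rw [meanSqResidual]
    field_simp

lemma sq_sub_le_card_mul_meanSqResidual (g : ℝ → ℝ) {i : Fin n} (hi : i ∈ s) :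
    (g (nodes i) - y i) ^ 2 ≤ s.card * meanSqResidual s nodes y g := by
  rw [card_mul_meanSqResidual]
  exact Finset.single_le_sum (f := fun i => (g (nodes i) - y i) ^ 2) (fun _ _ => sq_nonneg _) hi

namespace IsSmoothingSpline

lemma meanSqResidual_le (h : IsSmoothingSpline s nodes y lam u) (hlam : 0 ≤ lam) (w : SobolevH2) :
    meanSqResidual s nodes y u.toFun ≤ meanSqResidual s nodes y w.toFun + lam * w.roughness := by
  have hmin := h.1 w
  rw [splineObjective_eq, splineObjective_eq] at hmin
  linarith [mul_nonneg hlam u.roughness_nonneg]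

lemma roughness_le (h : IsSmoothingSpline s nodes y lam u) (hlam : 0 ≤ lam)
    (hw : ∀ i ∈ s, w.toFun (nodes i) = y i) : u.roughness ≤ w.roughness := by
  have hmin := h.1 w
  have hobj : splineObjective s nodes y lam w = lam * w.roughness := by
    rw [splineObjective_eq, meanSqResidual_eq_zero hw, zero_add]
  have hres := meanSqResidual_nonneg s nodes y u.toFun
  rw [hobj, splineObjective_eq] at hmin
  rcases hlam.eq_or_lt with rfl | hpos
  · refine h.2 w ?_
    rw [hobj, splineObjective_eq]
    linarith
  · exact le_of_mul_le_mul_left (by linarith) hpos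

lemma sq_sub_le (h : IsSmoothingSpline s nodes y lam u) (hlam : 0 ≤ lam)
    (hw : ∀ i ∈ s, w.toFun (nodes i) = y i) {i : Fin n} (hi : i ∈ s) :
    (u.toFun (nodes i) - w.toFun (nodes i)) ^ 2 ≤ s.card * (lam * w.roughness) := by
  have hres := h.meanSqResidual_le hlam w
  rw [meanSqResidual_eq_zero hw, zero_add] at hres
  rw [hw i hi]
  exact (sq_sub_le_card_mul_meanSqResidual u.toFun hi).trans
    (mul_le_mul_of_nonneg_left hres (Nat.cast_nonneg _))

-- Compare the spline with the zero function, whose roughness vanishes.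
lemma abs_le (h : IsSmoothingSpline s nodes y lam u) (hlam : 0 ≤ lam) {i : Fin n} (hi : i ∈ s) :
    |u.toFun (nodes i)| ≤ 2 * √(∑ j ∈ s, y j ^ 2) := by
  set z := SobolevH2.ofContDiff (fun _ => 0) contDiff_const
  have hz : ∀ t, z.toFun t = 0 := fun _ => rfl
  have hzr : z.roughness = 0 := by simp [z, SobolevH2.roughness, SobolevH2.ofContDiff,
    SobolevH2.ofHasDerivAt]
  have hres := h.meanSqResidual_le hlam z
  rw [hzr, mul_zero, add_zero] at hres
  have hfit : |u.toFun (nodes i) - y i| ≤ √(∑ j ∈ s, y j ^ 2) := by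
    refine abs_le_sqrt ((sq_sub_le_card_mul_meanSqResidual u.toFun hi).trans
      ((mul_le_mul_of_nonneg_left hres (Nat.cast_nonneg _)).trans_eq ?_))
    simp only [card_mul_meanSqResidual, hz, zero_sub, neg_sq]
  have hdata : |y i| ≤ √(∑ j ∈ s, y j ^ 2) :=
    abs_le_sqrt (Finset.single_le_sum (f := fun j => y j ^ 2) (fun _ _ => sq_nonneg _) hi)
  linarith [abs_sub_abs_le_abs_sub (u.toFun (nodes i)) (y i)]

lemma abs_der_le (h : IsSmoothingSpline s nodes y lam u) (hlam : 0 ≤ lam) {G : ℝ}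
    (hu : u.roughness ≤ G) {i j : Fin n} (hi : i ∈ s) (hj : j ∈ s)
    (hni : nodes i ∈ Icc (-1 : ℝ) 1) (hnj : nodes j ∈ Icc (-1 : ℝ) 1) (hij : nodes i ≠ nodes j)
    {t : ℝ} (ht : t ∈ Icc (-1 : ℝ) 1) :
    |u.der t| ≤ 4 * √(∑ k ∈ s, y k ^ 2) / |nodes j - nodes i| + √G * √(1 - -1) := by
  refine (abs_deriv_le_slope_add (fun t _ => u.hasDerivAt_ext t)
    (fun r hr t ht => SobolevH2.abs_der_sub_le hu hr ht) hni hnj hij ht).trans ?_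
  gcongr
  rw [← u.eqOn_ext hni, ← u.eqOn_ext hnj]
  linarith [abs_sub (u.toFun (nodes j)) (u.toFun (nodes i)), h.abs_le hlam hi, h.abs_le hlam hj]

end IsSmoothingSpline

end SmoothingSplines

section Encoder

variable {K : ℕ}

lemma exists_roughness_encoder_le (hK : 0 < K) (x : Fin K → ℝ) :
    ∃ W, 0 ≤ W ∧ ∀ (lam : ℝ) (u : SobolevH2), 0 ≤ lam →
      IsSmoothingSpline Finset.univ (encPoint K) x lam u →
      u.roughness ≤ W ∧ meanSqResidual Finset.univ (encPoint K) x u.toFun ≤ lam * W := by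
  set w := SobolevH2.ofContDiff (baccEnc x) (contDiff_berrut_univ hK (encPoint_strictAnti K) x)
  have hw : ∀ k ∈ Finset.univ, w.toFun (encPoint K k) = x k := fun k _ => baccEnc_encPoint x k
  refine ⟨w.roughness, w.roughness_nonneg, fun lam u hlam hu => ⟨hu.roughness_le hlam hw, ?_⟩⟩
  simpa only [meanSqResidual_eq_zero hw, zero_add] using hu.meanSqResidual_le hlam w

lemma exists_abs_der_encoder_le (hK : 2 ≤ K) (x : Fin K → ℝ) :
    ∃ B, ∀ (lam : ℝ) (u : SobolevH2), 0 ≤ lam →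
      IsSmoothingSpline Finset.univ (encPoint K) x lam u →
      ∀ t ∈ Icc (-1 : ℝ) 1, |u.der t| ≤ B := by
  obtain ⟨W, -, hW⟩ := exists_roughness_encoder_le (by omega) x
  have hne : encPoint K ⟨0, by omega⟩ ≠ encPoint K ⟨1, by omega⟩ := by
    simp [(encPoint_strictAnti K).injective.eq_iff]
  exact ⟨_, fun lam u hlam hu t ht => hu.abs_der_le hlam (hW lam u hlam hu).1
    (Finset.mem_univ _) (Finset.mem_univ _) (encPoint_mem_Icc _) (encPoint_mem_Icc _) hne ht⟩

lemma exists_sobolevH2_eqOn_comp_encoder (hK : 2 ≤ K) (x : Fin K → ℝ) {f : ℝ → ℝ} {ν : ℝ≥0}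
    {η : ℝ} (hν : LipschitzWith ν f) (hf : Differentiable ℝ f)
    (hf' : Differentiable ℝ (deriv f)) (hη : ∀ t, |deriv (deriv f) t| ≤ η) :
    ∃ G, ∀ (lam : ℝ) (u : SobolevH2), 0 ≤ lam →
      IsSmoothingSpline Finset.univ (encPoint K) x lam u →
      ∃ g : SobolevH2, g.roughness ≤ G ∧ EqOn g.toFun (f ∘ u.toFun) (Icc (-1) 1) := by
  obtain ⟨W, -, hW⟩ := exists_roughness_encoder_le (by omega) x
  obtain ⟨B, hB⟩ := exists_abs_der_encoder_le hK x
  refine ⟨4 * (η * B ^ 2) ^ 2 + 2 * (ν : ℝ) ^ 2 * W, fun lam u hlam hu =>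
    ⟨u.comp hf hf' hη, ?_, u.eqOn_comp hf hf' hη⟩⟩
  refine (u.roughness_comp_le hf hf' hη (fun t => norm_deriv_le_of_lipschitz hν)
    (hB lam u hlam hu)).trans ?_
  gcongr
  exact (hW lam u hlam hu).1

end Encoder

section LeTCC

variable {K N : ℕ} {f : ℝ → ℝ} {x : Fin K → ℝ}

lemma recoveryLoss_nonneg (f : ℝ → ℝ) (x : Fin K → ℝ) (u : ℝ → ℝ) : 0 ≤ recoveryLoss f x u := by
  rw [recoveryLoss]
  positivity

lemma recoveryLoss_le_add {u g : ℝ → ℝ} {D : ℝ} (hD : 0 ≤ D)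
    (h : ∀ k, (u (encPoint K k) - g (encPoint K k)) ^ 2 ≤ D) :
    recoveryLoss f x u ≤ 2 * D + 2 * recoveryLoss f x g := by
  have hpoint : ∀ k, (u (encPoint K k) - f (x k)) ^ 2 ≤
      2 * D + 2 * (g (encPoint K k) - f (x k)) ^ 2 := fun k =>
    calc (u (encPoint K k) - f (x k)) ^ 2
        = (u (encPoint K k) - g (encPoint K k) + (g (encPoint K k) - f (x k))) ^ 2 := by ring
      _ ≤ 2 * ((u (encPoint K k) - g (encPoint K k)) ^ 2 + (g (encPoint K k) - f (x k)) ^ 2) :=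
          add_sq_le
      _ ≤ 2 * D + 2 * (g (encPoint K k) - f (x k)) ^ 2 := by linarith [h k]
  calc recoveryLoss f x u
      ≤ 1 / (K : ℝ) * ∑ k, (2 * D + 2 * (g (encPoint K k) - f (x k)) ^ 2) := by
        rw [recoveryLoss]
        gcongr with k
        exact hpoint k
    _ = (K : ℝ)⁻¹ * K * (2 * D) + 2 * recoveryLoss f x g := by
        rw [recoveryLoss, Finset.sum_add_distrib, Finset.sum_const, Finset.card_univ,
          Fintype.card_fin, nsmul_eq_mul, ← Finset.mul_sum]
        ring
    _ ≤ 2 * D + 2 * recoveryLoss f x g := by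
        gcongr ?_ + _
        exact mul_le_of_le_one_left (by positivity) inv_mul_le_one

lemma recoveryLoss_comp_le {ν : ℝ≥0} (hν : LipschitzWith ν f) (u : ℝ → ℝ) :
    recoveryLoss f x (f ∘ u) ≤ ν ^ 2 * meanSqResidual Finset.univ (encPoint K) x u := by
  have hpoint : ∀ k, ((f ∘ u) (encPoint K k) - f (x k)) ^ 2 ≤
      (ν : ℝ) ^ 2 * (u (encPoint K k) - x k) ^ 2 := by
    intro k
    rw [← mul_pow, sq_le_sq, abs_mul, NNReal.abs_eq]
    exact hν.dist_le_mul _ _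
  calc recoveryLoss f x (f ∘ u)
      ≤ 1 / (K : ℝ) * ∑ k, (ν : ℝ) ^ 2 * (u (encPoint K k) - x k) ^ 2 := by
        rw [recoveryLoss]
        gcongr 1 / (K : ℝ) * ∑ k, ?_ with k
        exact hpoint k
    _ = ν ^ 2 * meanSqResidual Finset.univ (encPoint K) x u := by
        rw [meanSqResidual, ← Finset.mul_sum, Finset.card_univ, Fintype.card_fin]
        ring

lemma exists_recoveryLoss_comp_encoder_le (hK : 0 < K) (x : Fin K → ℝ) {ν : ℝ≥0}
    (hν : LipschitzWith ν f) (A : ℝ) :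
    ∃ C, 0 ≤ C ∧ ∀ (lam r : ℝ) (u : SobolevH2), 0 ≤ lam → 0 ≤ r → lam ≤ A * r →
      IsSmoothingSpline Finset.univ (encPoint K) x lam u →
      recoveryLoss f x (f ∘ u.toFun) ≤ C * r := by
  obtain ⟨W, hW0, hW⟩ := exists_roughness_encoder_le hK x
  refine ⟨ν ^ 2 * (|A| * W), by positivity, fun lam r u hlam hr hlamr hu => ?_⟩
  calc recoveryLoss f x (f ∘ u.toFun)
      ≤ ν ^ 2 * meanSqResidual Finset.univ (encPoint K) x u.toFun := recoveryLoss_comp_le hν _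
    _ ≤ ν ^ 2 * (lam * W) := by
        gcongr
        exact (hW lam u hlam hu).2
    _ ≤ ν ^ 2 * (|A| * r * W) := by
        gcongr
        exact hlamr.trans (by gcongr; exact le_abs_self A)
    _ = ν ^ 2 * (|A| * W) * r := by ring

lemma NoLongGap.exists_decPoint_near (hN : 2 ≤ N) {R : ℕ} {F : Finset (Fin N)}
    (hF : NoLongGap R F) {θ : ℝ} (hθ : R * decStep N ≤ θ) (hθπ : θ + R * decStep N ≤ π) :
    ∃ v ∈ F, ∃ w ∈ F, decPoint N v < cos θ ∧ cos θ ≤ decPoint N w ∧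
      decPoint N w - decPoint N v ≤ 2 * (R * decStep N) := by
  have hstep : 0 ≤ R * decStep N := mul_nonneg (Nat.cast_nonneg _) (decStep_pos hN).le
  obtain ⟨v, hv, hθv, hvθ⟩ := hF.exists_angle_mem_Ioc hN (hstep.trans hθ) hθπ
  obtain ⟨w, hw, hθw, hwθ⟩ :=
    hF.exists_angle_mem_Ioc hN (θ := θ - R * decStep N) (by linarith) (by linarith)
  simp only [decPoint_eq_cos]
  refine ⟨v, hv, w, hw,
    cos_lt_cos_of_nonneg_of_le_pi (hstep.trans hθ) (mul_decStep_mem_Icc hN v).2 hθv,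
    cos_le_cos_of_nonneg_of_le_pi (mul_decStep_mem_Icc hN w).1 (by linarith) (by linarith), ?_⟩
  refine (le_abs_self _).trans ((abs_cos_sub_cos_le _ _).trans ?_)
  rw [abs_le]
  constructor <;> linarith

lemma SobolevH2.sq_sub_le_of_mem_Icc {u g : SobolevH2} {G r a b z : ℝ} (hu : u.roughness ≤ G)
    (hg : g.roughness ≤ G) (hab : a < b) (hI : Icc a b ⊆ Icc (-1) 1)
    (hra : |u.toFun a - g.toFun a| ≤ r) (hrb : |u.toFun b - g.toFun b| ≤ r) (hz : z ∈ Icc a b) :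
    (u.toFun z - g.toFun z) ^ 2 ≤ 18 * r ^ 2 + 8 * G * (b - a) ^ 3 := by
  have hG : 0 ≤ G := u.roughness_nonneg.trans hu
  have hr : 0 ≤ r := (abs_nonneg _).trans hra
  have hba : 0 < b - a := sub_pos.2 hab
  have hdist : |z - a| ≤ b - a := by
    rw [abs_of_nonneg (sub_nonneg.2 hz.1)]
    linarith [hz.2]
  have hsub : |u.toFun z - g.toFun z| ≤ 3 * r + 2 * √G * √(b - a) * (b - a) :=
    calc |u.toFun z - g.toFun z| ≤ r + (2 * r / |b - a| + 2 * √G * √(b - a)) * |z - a| :=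
          SobolevH2.abs_sub_le hu hg hI (left_mem_Icc.2 hab.le) (right_mem_Icc.2 hab.le) hab.ne
            hra hrb hz
      _ ≤ r + (2 * r / (b - a) + 2 * √G * √(b - a)) * (b - a) := by
          rw [abs_of_pos hba]
          gcongr
      _ = 3 * r + 2 * √G * √(b - a) * (b - a) := by
          field_simp
          ring
  calc (u.toFun z - g.toFun z) ^ 2 ≤ (3 * r + 2 * √G * √(b - a) * (b - a)) ^ 2 :=
        sq_le_sq' (abs_le.1 hsub).1 (abs_le.1 hsub).2
    _ ≤ 2 * ((3 * r) ^ 2 + (2 * √G * √(b - a) * (b - a)) ^ 2) := add_sq_le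
    _ = 18 * r ^ 2 + 8 * √G ^ 2 * √(b - a) ^ 2 * (b - a) ^ 2 := by ring
    _ = 18 * r ^ 2 + 8 * G * (b - a) ^ 3 := by
        rw [sq_sqrt hG, sq_sqrt hba.le]
        ring

section Decoder

variable {F : Finset (Fin N)} {y : Fin N → ℝ} {lam G : ℝ} {u g : SobolevH2}

lemma abs_sub_decPoint_le (hN : 2 ≤ N) (hu : IsSmoothingSpline F (decPoint N) y lam u)
    (hlam : 0 ≤ lam) (hlamN : lam ≤ (N : ℝ) ^ (-6 : ℤ))
    (hg : ∀ v ∈ F, g.toFun (decPoint N v) = y v) (hG : g.roughness ≤ G) {v : Fin N} (hv : v ∈ F) :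
    |u.toFun (decPoint N v) - g.toFun (decPoint N v)| ≤ √G / (N : ℝ) ^ 2 := by
  have hG0 : 0 ≤ G := g.roughness_nonneg.trans hG
  have hN1 : (1 : ℝ) ≤ N := by exact_mod_cast (by omega : 1 ≤ N)
  have hcard : (F.card : ℝ) ≤ N := by exact_mod_cast (Finset.card_le_univ F).trans_eq (by simp)
  refine abs_le_of_sq_le_sq ?_ (by positivity)
  calc (u.toFun (decPoint N v) - g.toFun (decPoint N v)) ^ 2
      ≤ F.card * (lam * g.roughness) := hu.sq_sub_le hlam hg hv
    _ ≤ N * ((N : ℝ) ^ (-6 : ℤ) * G) := by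
        have := g.roughness_nonneg
        gcongr
    _ = G / (N : ℝ) ^ 5 := by
        rw [zpow_neg, zpow_ofNat]
        field_simp
    _ ≤ G / (N : ℝ) ^ 4 := by
        gcongr
        norm_num
    _ = (√G / (N : ℝ) ^ 2) ^ 2 := by
        rw [div_pow, sq_sqrt hG0]
        ring

lemma sq_decoder_sub_le_of_noLongGap (hN : 2 ≤ N)
    (hu : IsSmoothingSpline F (decPoint N) y lam u) (hlam : 0 ≤ lam)
    (hlamN : lam ≤ (N : ℝ) ^ (-6 : ℤ)) (hg : ∀ v ∈ F, g.toFun (decPoint N v) = y v)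
    (hG : g.roughness ≤ G) {R : ℕ} (hF : NoLongGap R F) {θ : ℝ} (hθ : R * decStep N ≤ θ)
    (hθπ : θ + R * decStep N ≤ π) :
    (u.toFun (cos θ) - g.toFun (cos θ)) ^ 2 ≤
      18 * G * ((N : ℝ) ^ 4)⁻¹ + 64 * G * (R * decStep N) ^ 3 := by
  have hG0 : 0 ≤ G := g.roughness_nonneg.trans hG
  obtain ⟨v, hv, w, hw, hvθ, hθw, hvw⟩ := hF.exists_decPoint_near hN hθ hθπ
  have hgap : 0 ≤ decPoint N w - decPoint N v := by linarith
  calc (u.toFun (cos θ) - g.toFun (cos θ)) ^ 2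
      ≤ 18 * (√G / (N : ℝ) ^ 2) ^ 2 + 8 * G * (decPoint N w - decPoint N v) ^ 3 :=
        SobolevH2.sq_sub_le_of_mem_Icc ((hu.roughness_le hlam hg).trans hG) hG
          (hvθ.trans_le hθw) (Icc_subset_Icc (decPoint_mem_Icc v).1 (decPoint_mem_Icc w).2)
          (abs_sub_decPoint_le hN hu hlam hlamN hg hG hv)
          (abs_sub_decPoint_le hN hu hlam hlamN hg hG hw) ⟨hvθ.le, hθw⟩
    _ ≤ 18 * (√G / (N : ℝ) ^ 2) ^ 2 + 8 * G * (2 * (R * decStep N)) ^ 3 := by gcongr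
    _ = 18 * G * ((N : ℝ) ^ 4)⁻¹ + 64 * G * (R * decStep N) ^ 3 := by
        rw [div_pow, sq_sqrt hG0]
        ring

lemma two_div_sq_le_abs_decPoint_sub (hN : 2 ≤ N) {v w : Fin N} (hvw : v ≠ w) :
    2 / (N : ℝ) ^ 2 ≤ |decPoint N w - decPoint N v| := by
  have hmono : 2 / (N : ℝ) ^ 2 ≤ 2 / ((N : ℝ) - 1) ^ 2 := by
    have := cast_sub_one_pos hN
    gcongr
    linarith
  rcases hvw.lt_or_gt with h | h
  · rw [abs_sub_comm]
    exact hmono.trans ((le_decPoint_sub hN h).trans (le_abs_self _))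
  · exact hmono.trans ((le_decPoint_sub hN h).trans (le_abs_self _))

lemma sq_decoder_sub_le (hN : 2 ≤ N) (hF : 2 ≤ F.card)
    (hu : IsSmoothingSpline F (decPoint N) y lam u) (hlam : 0 ≤ lam)
    (hlamN : lam ≤ (N : ℝ) ^ (-6 : ℤ)) (hg : ∀ v ∈ F, g.toFun (decPoint N v) = y v)
    (hG : g.roughness ≤ G) {z : ℝ} (hz : z ∈ Icc (-1 : ℝ) 1) :
    (u.toFun z - g.toFun z) ^ 2 ≤ 81 * G := by
  have hG0 : 0 ≤ G := g.roughness_nonneg.trans hG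
  have hN1 : 1 ≤ (N : ℝ) ^ 2 := one_le_pow₀ (by exact_mod_cast (by omega : 1 ≤ N))
  obtain ⟨v, hv, w, hw, hvw⟩ := Finset.one_lt_card.1 hF
  have hdist : |z - decPoint N v| ≤ 2 := by
    rw [abs_le]
    constructor <;> linarith [hz.1, hz.2, (decPoint_mem_Icc v).1, (decPoint_mem_Icc v).2]
  have hsqrt : √(1 - -1 : ℝ) ≤ 3 / 2 := sqrt_le_iff.2 ⟨by norm_num, by norm_num⟩
  have hsub : |u.toFun z - g.toFun z| ≤ 9 * √G :=
    calc |u.toFun z - g.toFun z|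
        ≤ √G / (N : ℝ) ^ 2 + (2 * (√G / (N : ℝ) ^ 2) / |decPoint N w - decPoint N v| +
            2 * √G * √(1 - -1)) * |z - decPoint N v| :=
          SobolevH2.abs_sub_le ((hu.roughness_le hlam hg).trans hG) hG subset_rfl
            (decPoint_mem_Icc v) (decPoint_mem_Icc w) ((decPoint_strictAnti hN).injective.ne hvw)
            (abs_sub_decPoint_le hN hu hlam hlamN hg hG hv)
            (abs_sub_decPoint_le hN hu hlam hlamN hg hG hw) hz
      _ ≤ √G + (2 * (√G / (N : ℝ) ^ 2) / (2 / (N : ℝ) ^ 2) + 2 * √G * (3 / 2)) * 2 := by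
          gcongr
          · exact div_le_self (sqrt_nonneg G) hN1
          · exact two_div_sq_le_abs_decPoint_sub hN hvw
      _ = 9 * √G := by
          field_simp
          norm_num
  calc (u.toFun z - g.toFun z) ^ 2 ≤ (9 * √G) ^ 2 :=
        sq_le_sq' (abs_le.1 hsub).1 (abs_le.1 hsub).2
    _ = 81 * G := by
        rw [mul_pow, sq_sqrt hG0]
        norm_num

end Decoder

variable {p : ℝ}

lemma inv_pow_le_leTCCRate (hN : 1 ≤ N) (hlog : 1 ≤ logb (1 / p) N) {k : ℕ} (hk : 3 ≤ k) :
    ((N : ℝ) ^ k)⁻¹ ≤ leTCCRate p N := by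
  have : (1 : ℝ) ≤ N := by exact_mod_cast hN
  rw [leTCCRate, ← one_div]
  gcongr
  exact one_le_pow₀ hlog

lemma leTCCRate_nonneg (hlog : 1 ≤ logb (1 / p) N) : 0 ≤ leTCCRate p N := by
  rw [leTCCRate]
  positivity

namespace IsLeTCC

variable {lamEnc lamDec M G : ℝ} {enc g : SobolevH2} {dec : Finset (Fin N) → SobolevH2}

lemma recoveryLoss_le_of_noLongGap (h : IsLeTCC f x lamEnc lamDec M enc dec)
    (hlam : 0 ≤ lamDec) (hlamN : lamDec ≤ (N : ℝ) ^ (-6 : ℤ))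
    (hg : EqOn g.toFun (f ∘ enc.toFun) (Icc (-1) 1)) (hG : g.roughness ≤ G) (hN : 2 ≤ N)
    (hlog : 1 ≤ logb (1 / p) N)
    (hwindow : ((windowLength p N : ℝ) + 1) * decStep N ≤ π / (2 * K)) {F : Finset (Fin N)}
    (hF : NoLongGap (windowLength p N) F) :
    recoveryLoss f x (dec F).toFun ≤
      2 * (G * (18 + 64 * (18 * π) ^ 3) * leTCCRate p N) +
        2 * recoveryLoss f x (f ∘ enc.toFun) := by
  have hG0 : 0 ≤ G := g.roughness_nonneg.trans hG
  have hstep := decStep_pos hN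
  have hrate := leTCCRate_nonneg hlog
  have hlen : windowLength p N * decStep N ≤ (windowLength p N + 1) * decStep N := by
    gcongr
    linarith
  have hcube : (windowLength p N * decStep N) ^ 3 ≤ (18 * π) ^ 3 * leTCCRate p N :=
    calc (windowLength p N * decStep N) ^ 3 ≤ (18 * π * (logb (1 / p) N / N)) ^ 3 :=
          pow_le_pow_left₀ (by positivity)
            (hlen.trans (windowLength_add_one_mul_decStep_le hN hlog)) 3
      _ = (18 * π) ^ 3 * leTCCRate p N := by
          rw [leTCCRate]
          ring
  refine recoveryLoss_le_add (by positivity) fun k => ?_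
  have hθ : windowLength p N * decStep N ≤ encAngle K k :=
    (hlen.trans hwindow).trans (encAngle_mem_Icc k).1
  have hθπ : encAngle K k + windowLength p N * decStep N ≤ π := by
    linarith [(encAngle_mem_Icc k).2]
  have hcard : 2 ≤ F.card := by
    obtain ⟨v, hv, w, hw, hvθ, hθw, -⟩ := hF.exists_decPoint_near hN hθ hθπ
    exact Finset.one_lt_card.2 ⟨v, hv, w, hw, fun hvw => (hvθ.trans_le hθw).ne (by rw [hvw])⟩
  calc ((dec F).toFun (encPoint K k) - (f ∘ enc.toFun) (encPoint K k)) ^ 2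
      = ((dec F).toFun (encPoint K k) - g.toFun (encPoint K k)) ^ 2 := by
        rw [hg (encPoint_mem_Icc k)]
    _ ≤ 18 * G * ((N : ℝ) ^ 4)⁻¹ + 64 * G * (windowLength p N * decStep N) ^ 3 :=
        sq_decoder_sub_le_of_noLongGap hN (h.decoder F hcard) hlam hlamN
          (fun v _ => hg (decPoint_mem_Icc v)) hG hF hθ hθπ
    _ ≤ 18 * G * leTCCRate p N + 64 * G * ((18 * π) ^ 3 * leTCCRate p N) := by
        gcongr
        exact inv_pow_le_leTCCRate (by omega) hlog (by norm_num)
    _ = G * (18 + 64 * (18 * π) ^ 3) * leTCCRate p N := by ring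

lemma recoveryLoss_le (h : IsLeTCC f x lamEnc lamDec M enc dec) (hlam : 0 ≤ lamDec)
    (hlamN : lamDec ≤ (N : ℝ) ^ (-6 : ℤ)) (hg : EqOn g.toFun (f ∘ enc.toFun) (Icc (-1) 1))
    (hG : g.roughness ≤ G) (hN : 2 ≤ N) (F : Finset (Fin N)) :
    recoveryLoss f x (dec F).toFun ≤
      2 * (81 * G) + (M + ∑ k, |f (x k)|) ^ 2 + 2 * recoveryLoss f x (f ∘ enc.toFun) := by
  have hG0 : 0 ≤ G := g.roughness_nonneg.trans hG
  rcases lt_or_ge F.card 2 with hF | hF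
  · have hvalue : ∀ k, |f (x k)| ≤ ∑ k, |f (x k)| := fun k =>
      Finset.single_le_sum (f := fun k => |f (x k)|) (fun k _ => abs_nonneg _) (Finset.mem_univ k)
    have hfallback : recoveryLoss f x (dec F).toFun ≤ (M + ∑ k, |f (x k)|) ^ 2 :=
      recoveryLoss_le_sq fun k => (abs_sub _ _).trans (add_le_add (h.fallback F hF k) (hvalue k))
    linarith [recoveryLoss_nonneg f x (f ∘ enc.toFun)]
  · have hspline : recoveryLoss f x (dec F).toFun ≤
        2 * (81 * G) + 2 * recoveryLoss f x (f ∘ enc.toFun) := by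
      refine recoveryLoss_le_add (by positivity) fun k => ?_
      rw [← hg (encPoint_mem_Icc k)]
      exact sq_decoder_sub_le hN hF (h.decoder F hF) hlam hlamN
        (fun v _ => hg (decPoint_mem_Icc v)) hG (encPoint_mem_Icc k)
    linarith [sq_nonneg (M + ∑ k, |f (x k)|)]

end IsLeTCC

theorem leTCC_expect_le (hp0 : 0 < p) (hp1 : p < 1) (hK : 2 ≤ K) (x : Fin K → ℝ) {ν : ℝ≥0}
    {η : ℝ} (hν : LipschitzWith ν f) (hf : Differentiable ℝ f) (hf' : Differentiable ℝ (deriv f))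
    (hη : ∀ t, |deriv (deriv f) t| ≤ η) (A M : ℝ) :
    ∃ (C : ℝ) (n₀ : ℕ), ∀ N : ℕ, n₀ ≤ N → ∀ lamEnc lamDec : ℝ, 0 ≤ lamEnc → 0 ≤ lamDec →
      lamDec ≤ (N : ℝ) ^ (-6 : ℤ) →
      ∀ (enc : SobolevH2) (dec : Finset (Fin N) → SobolevH2),
        IsLeTCC f x lamEnc lamDec M enc dec →
        expect p (fun F => recoveryLoss f x (dec F).toFun)
            ≤ C * leTCCRate p N + 2 * recoveryLoss f x (f ∘ enc.toFun) ∧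
        (lamEnc ≤ A * leTCCRate p N →
          expect p (fun F => recoveryLoss f x (dec F).toFun) ≤ C * leTCCRate p N) := by
  obtain ⟨G, hG⟩ := exists_sobolevH2_eqOn_comp_encoder hK x hν hf hf' hη
  obtain ⟨B, hB, hencoder⟩ := exists_recoveryLoss_comp_encoder_le (by omega) x hν A
  set C₁ := 2 * (G * (18 + 64 * (18 * π) ^ 3))
  set C₂ := 2 * (81 * G) + (M + ∑ k, |f (x k)|) ^ 2
  refine ⟨C₁ + C₂ + 2 * B, eventually_atTop.1 ?_⟩
  filter_upwards [eventually_ge_atTop 2, eventually_one_le_logb hp0 hp1,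
    (tendsto_windowLength_add_one_mul_decStep hp0 hp1).eventually_le_const
      (by positivity : 0 < π / (2 * K)), eventually_expect_le hp0 hp1]
    with N hN hlog hwindow hexpect lamEnc lamDec hlamEnc hlam hlamN enc dec h
  obtain ⟨g, hgG, hg⟩ := hG lamEnc enc hlamEnc h.encoder
  have hG0 : 0 ≤ G := g.roughness_nonneg.trans hgG
  have hC₂ : 0 ≤ C₂ := by positivity
  have hrate := leTCCRate_nonneg hlog
  have hencRate : 0 ≤ B * leTCCRate p N := by positivity
  have hmean : expect p (fun F => recoveryLoss f x (dec F).toFun) ≤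
      (C₁ + C₂) * leTCCRate p N + 2 * recoveryLoss f x (f ∘ enc.toFun) :=
    calc expect p (fun F => recoveryLoss f x (dec F).toFun)
        ≤ C₁ * leTCCRate p N + 2 * recoveryLoss f x (f ∘ enc.toFun) + C₂ * ((N : ℝ) ^ 6)⁻¹ := by
          refine hexpect _ _ _ hC₂ (fun F hF => ?_) fun F => ?_
          · exact (h.recoveryLoss_le_of_noLongGap hlam hlamN hg hgG hN hlog hwindow hF).trans_eq
              (by ring)
          · have : 0 ≤ C₁ * leTCCRate p N := by positivity
            linarith [h.recoveryLoss_le hlam hlamN hg hgG hN F]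
      _ ≤ C₁ * leTCCRate p N + 2 * recoveryLoss f x (f ∘ enc.toFun) + C₂ * leTCCRate p N := by
          gcongr
          exact inv_pow_le_leTCCRate (by omega) hlog (by norm_num)
      _ = (C₁ + C₂) * leTCCRate p N + 2 * recoveryLoss f x (f ∘ enc.toFun) := by ring
  refine ⟨by linarith, fun hA => ?_⟩
  linarith [hencoder lamEnc _ enc hlamEnc hrate hA h.encoder]

theorem leTCC_prob_ge (hp0 : 0 < p) (hp1 : p < 1) (hK : 2 ≤ K) (x : Fin K → ℝ) {ν : ℝ≥0}
    {η : ℝ} (hν : LipschitzWith ν f) (hf : Differentiable ℝ f) (hf' : Differentiable ℝ (deriv f))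
    (hη : ∀ t, |deriv (deriv f) t| ≤ η) (A M : ℝ) {δ : ℝ} (hδ : 0 < δ) :
    ∃ (C : ℝ) (n₀ : ℕ), ∀ N : ℕ, n₀ ≤ N → ∀ lamEnc lamDec : ℝ, 0 ≤ lamEnc → 0 ≤ lamDec →
      lamDec ≤ (N : ℝ) ^ (-6 : ℤ) →
      ∀ (enc : SobolevH2) (dec : Finset (Fin N) → SobolevH2),
        IsLeTCC f x lamEnc lamDec M enc dec →
        1 - δ ≤ prob p (fun F : Finset (Fin N) => recoveryLoss f x (dec F).toFun
            ≤ C * leTCCRate p N + 2 * recoveryLoss f x (f ∘ enc.toFun)) ∧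
        (lamEnc ≤ A * leTCCRate p N →
          1 - δ ≤ prob p (fun F : Finset (Fin N) =>
            recoveryLoss f x (dec F).toFun ≤ C * leTCCRate p N)) := by
  obtain ⟨G, hG⟩ := exists_sobolevH2_eqOn_comp_encoder hK x hν hf hf' hη
  obtain ⟨B, hB, hencoder⟩ := exists_recoveryLoss_comp_encoder_le (by omega) x hν A
  set C₁ := 2 * (G * (18 + 64 * (18 * π) ^ 3))
  refine ⟨C₁ + 2 * B, eventually_atTop.1 ?_⟩
  filter_upwards [eventually_ge_atTop 2, eventually_one_le_logb hp0 hp1,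
    (tendsto_windowLength_add_one_mul_decStep hp0 hp1).eventually_le_const
      (by positivity : 0 < π / (2 * K)), eventually_le_prob_le hp0 hp1 hδ]
    with N hN hlog hwindow hprob lamEnc lamDec hlamEnc hlam hlamN enc dec h
  obtain ⟨g, hgG, hg⟩ := hG lamEnc enc hlamEnc h.encoder
  have hrate := leTCCRate_nonneg hlog
  have hencRate : 0 ≤ B * leTCCRate p N := by positivity
  have hgood : ∀ F : Finset (Fin N), NoLongGap (windowLength p N) F →
      recoveryLoss f x (dec F).toFun ≤
        C₁ * leTCCRate p N + 2 * recoveryLoss f x (f ∘ enc.toFun) := fun F hF =>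
    (h.recoveryLoss_le_of_noLongGap hlam hlamN hg hgG hN hlog hwindow hF).trans_eq (by ring)
  refine ⟨hprob _ _ fun F hF => (hgood F hF).trans (by linarith), fun hA => ?_⟩
  have hfit := hencoder lamEnc _ enc hlamEnc hrate hA h.encoder
  exact hprob _ _ fun F hF => by linarith [hgood F hF]

end LeTCC

end CodedComputing

theorem corollary2 (p : ℝ) (hp0 : 0 < p) (hp1 : p < 1) (K : ℕ) (x : Fin K → ℝ) (f : ℝ → ℝ) :
    -- LeTCC
    (2 ≤ K → ∀ (ν : ℝ≥0) (η : ℝ), LipschitzWith ν f → Differentiable ℝ f →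
      Differentiable ℝ (deriv f) → (∀ t, |deriv (deriv f) t| ≤ η) → ∀ A M : ℝ,
      -- average approximation error
      (∃ (C : ℝ) (n₀ : ℕ), ∀ N : ℕ, n₀ ≤ N → ∀ lamEnc lamDec : ℝ, 0 ≤ lamEnc → 0 ≤ lamDec →
        lamDec ≤ (N : ℝ) ^ (-6 : ℤ) →
        ∀ (enc : CodedComputing.SobolevH2) (dec : Finset (Fin N) → CodedComputing.SobolevH2),
          CodedComputing.IsLeTCC f x lamEnc lamDec M enc dec →
          CodedComputing.expect p (fun F => CodedComputing.recoveryLoss f x (dec F).toFun)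
              ≤ C * CodedComputing.leTCCRate p N
                + 2 * CodedComputing.recoveryLoss f x (f ∘ enc.toFun) ∧
          (lamEnc ≤ A * CodedComputing.leTCCRate p N →
            CodedComputing.expect p (fun F => CodedComputing.recoveryLoss f x (dec F).toFun)
              ≤ C * CodedComputing.leTCCRate p N)) ∧
      -- approximation error, with high probability
      (∀ δ ∈ Ioo (0 : ℝ) 1, ∃ (C : ℝ) (n₀ : ℕ), ∀ N : ℕ, n₀ ≤ N →
        ∀ lamEnc lamDec : ℝ, 0 ≤ lamEnc → 0 ≤ lamDec → lamDec ≤ (N : ℝ) ^ (-6 : ℤ) →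
        ∀ (enc : CodedComputing.SobolevH2) (dec : Finset (Fin N) → CodedComputing.SobolevH2),
          CodedComputing.IsLeTCC f x lamEnc lamDec M enc dec →
          1 - δ ≤ CodedComputing.prob p (fun F : Finset (Fin N) =>
            CodedComputing.recoveryLoss f x (dec F).toFun
              ≤ C * CodedComputing.leTCCRate p N
                + 2 * CodedComputing.recoveryLoss f x (f ∘ enc.toFun)) ∧
          (lamEnc ≤ A * CodedComputing.leTCCRate p N →
            1 - δ ≤ CodedComputing.prob p (fun F : Finset (Fin N) =>
              CodedComputing.recoveryLoss f x (dec F).toFun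
                ≤ C * CodedComputing.leTCCRate p N)))) ∧
    -- BACC
    (1 ≤ K → ContDiff ℝ 2 f →
      (∃ (C : ℝ) (n₀ : ℕ), ∀ N : ℕ, n₀ ≤ N →
        CodedComputing.expect p (fun F : Finset (Fin N) =>
            CodedComputing.recoveryLoss f x (CodedComputing.baccDec f x F))
          ≤ C * CodedComputing.baccRate p N) ∧
      (∀ δ ∈ Ioo (0 : ℝ) 1, ∃ (C : ℝ) (n₀ : ℕ), ∀ N : ℕ, n₀ ≤ N →
        1 - δ ≤ CodedComputing.prob p (fun F : Finset (Fin N) =>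
          CodedComputing.recoveryLoss f x (CodedComputing.baccDec f x F)
            ≤ C * CodedComputing.baccRate p N))) ∧
    -- the ratio of largest and smallest spacing of the decoder points is `O(N)` and unbounded
    ((fun N : ℕ => CodedComputing.maxGap N / CodedComputing.minGap N)
        =O[atTop] (fun N : ℕ => (N : ℝ))) ∧
    Tendsto (fun N : ℕ => CodedComputing.maxGap N / CodedComputing.minGap N) atTop atTop := by
  refine ⟨fun hK ν η hν hf hf' hη A M => ⟨?_, fun δ hδ => ?_⟩, fun hK hf => ⟨?_, fun δ hδ => ?_⟩,
    CodedComputing.maxGap_div_minGap_isBigO, CodedComputing.tendsto_maxGap_div_minGap⟩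
  · exact CodedComputing.leTCC_expect_le hp0 hp1 hK x hν hf hf' hη A M
  · exact CodedComputing.leTCC_prob_ge hp0 hp1 hK x hν hf hf' hη A M hδ.1
  · exact CodedComputing.bacc_expect_le hp0 hp1 hK x hf
  · exact CodedComputing.bacc_prob_ge hp0 hp1 hK x hf hδ.1
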